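/- **Lemma 4.6 (Induction).** A *signature* of arity $m$ is a function $f:\{0,1\}^m\to\mathbb{C}$. It is an *Eulerian orientation (EO) signature* if $m=2n$ for some $n>0$ and $f(\alpha)\neq 0$ only for strings $\alpha$ of Hamming weight $n$; it satisfies *arrow reversal symmetry* (ARS) if $f(\overline{\alpha})=\overline{f(\alpha)}$ for all $\alpha$, where $\overline{\alpha}$ is the bitwise complement of $\alpha$. Let $\mathcal{B}$ be the set of all signatures that are tensor products (up to a permutation of the variables) of one or more binary EO signatures satisfying ARS. For a set $\mathcal{F}$ of EO signatures, $\#\mathrm{EO}(\mathcal{F})$ is the following problem. The input is a signature grid over $\mathcal{F}$: a finite multigraph $G=(V,E)$ (loops and parallel edges allowed) in which each vertex $v$ is labelled with a signature $f_v\in\mathcal{F}$ of arity $\deg(v)$ and the edge ends at $v$ are labelled with the input variables of $f_v$. The output is $$\sum_{\sigma}\ \prod_{v\in V} f_v(\sigma|_{E(v)}),$$ where $\sigma$ ranges over the Eulerian orientations of $G$ (as many incoming as outgoing edges at each vertex) and $\sigma|_{E(v)}$ assigns $0$ to the incoming and $1$ to the outgoing edge ends at $v$. We write $\leq_T$ for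 polynomial-time Turing reducibility, with exact arithmetic on complex numbers. Let $\mathcal{F}$ be a set of EO signatures satisfying ARS. If $\mathcal{F}$ contains a signature $f\notin\mathcal{B}$ of arity $2n\geq 10$, then there is an EO signature $g\notin\mathcal{B}$ of arity $2n-2$ satisfying ARS such that $$\#\mathrm{EO}(\{g\}\cup\mathcal{F})\ \leq_T\ \#\mathrm{EO}(\mathcal{F}).$$ -/

import Mathlib

/-! ### Signatures -/

/-- A signature (constraint function) of arity `m`: a map `{0,1}^m → ℂ`, where `false` is `0` and
`true` is `1`. -/
structure Signature where
  arity : ℕ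
  val : (Fin arity → Bool) → ℂ

namespace Signature

/-- The Hamming weight of a 0-1 string. -/
def wt {m : ℕ} (α : Fin m → Bool) : ℕ :=
  (Finset.univ.filter fun i => α i = true).card

/-- Eulerian orientation signatures: the arity is `2n` with `n > 0`, and the support consists of
strings of Hamming weight `n`. -/
def IsEO (f : Signature) : Prop :=
  ∃ n : ℕ, 0 < n ∧ f.arity = 2 * n ∧ ∀ α, f.val α ≠ 0 → wt α = n

/-- Arrow reversal symmetry: complementing all the bits of the input conjugates the value. -/
def IsARS (f : Signature) : Prop :=
  ∀ α : Fin f.arity → Bool, f.val (fun i => !(α i)) = starRingEnd ℂ (f.val α)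

/-- The set of all tensor products, on arbitrarily permuted variables, of one or more binary
EO signatures with arrow reversal symmetry. The `j`-th factor is `b j`, applied to the variables
`e (j, 0)` and `e (j, 1)`; each variable belongs to exactly one factor. -/
def setB : Set Signature :=
  {f | ∃ (k : ℕ) (b : Fin k → (Fin 2 → Bool) → ℂ) (e : Fin k × Fin 2 ≃ Fin f.arity),
    0 < k ∧ (∀ j, IsEO ⟨2, b j⟩ ∧ IsARS ⟨2, b j⟩) ∧
    ∀ α, f.val α = ∏ j, b j (fun i => α (e (j, i)))}

end Signature

/-! ### Signature grids and the partition function -/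

/-- A vertex of a signature grid: its signature, and for each input variable of the signature
the name (a bit string) of the incident edge that is labelled by this variable. -/
structure Vertex where
  sig : Signature
  edge : Fin sig.arity → List Bool

/-- The edge ends: the pairs of a vertex and an input variable of its signature. -/
abbrev EdgeEnd {n : ℕ} (vertex : Fin n → Vertex) : Type :=
  (v : Fin n) × Fin (vertex v).sig.arity

/-- The name of the edge that an edge end belongs to. -/
def edgeOf {n : ℕ} (vertex : Fin n → Vertex) (p : EdgeEnd vertex) : List Bool :=
  (vertex p.1).edge p.2

/-- A signature grid over `F`: a finite multigraph (parallel edges and loops are allowed) whose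
vertices carry signatures from `F`. Every edge has exactly two ends; the degree of a vertex
is the arity of its signature (a loop contributes two to it). -/
structure SignatureGrid (F : Set Signature) where
  order : ℕ
  vertex : Fin order → Vertex
  sig_mem : ∀ v, (vertex v).sig ∈ F
  two_ends : ∀ p : EdgeEnd vertex, ∃! q : EdgeEnd vertex,
    q ≠ p ∧ edgeOf vertex q = edgeOf vertex p

/-- An assignment to the edge ends is an orientation if the two ends of every edge get different
values: `0` (`false`) at the head and `1` (`true`) at the tail. -/
def IsOrientation {n : ℕ} (vertex : Fin n → Vertex) (σ : EdgeEnd vertex → Bool) : Prop :=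
  ∀ p q, p ≠ q → edgeOf vertex p = edgeOf vertex q → σ p ≠ σ q

/-- An Eulerian orientation: at each vertex the number of incoming edges is equal to the number
of outgoing edges. -/
def IsEulerianOrientation {n : ℕ} (vertex : Fin n → Vertex) (σ : EdgeEnd vertex → Bool) : Prop :=
  IsOrientation vertex σ ∧
    ∀ v, (Finset.univ.filter fun i => σ ⟨v, i⟩ = false).card =
      (Finset.univ.filter fun i => σ ⟨v, i⟩ = true).card

open Classical in
/-- The partition function: the sum over all Eulerian orientations of the product over all vertices
of the value of the signature at the local assignment. -/
noncomputable def partitionFunction {n : ℕ} (vertex : Fin n → Vertex) : ℂ :=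
  ∑ σ ∈ Finset.univ.filter (IsEulerianOrientation vertex),
    ∏ v, (vertex v).sig.val (fun i => σ ⟨v, i⟩)

/-! ### Words and counting problems -/

/-- The letters (symbols) that machines work with: bits, a separator, labels that stand for signatures, and
complex numbers. -/
inductive Letter where
  | bit (b : Bool)
  | sep
  | label (f : Signature)
  | number (z : ℂ)

/-- A counting problem: instances, written down as words, and the complex number to be computed
for each instance, which depends only on the word. -/
structure CountingProblem where
  Instance : Type
  word : Instance → List Letter
  value : Instance → ℂ
  value_eq_of_word_eq : ∀ x y, word x = word y → value x = value y

/-- A vertex is written as the label of its signature followed by the names of the incident edges,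
in the order of the input variables. -/
def Vertex.word (v : Vertex) : List Letter :=
  Letter.label v.sig ::
    (List.ofFn v.edge).flatMap (fun name => Letter.sep :: name.map Letter.bit)

/-- A signature grid is written down vertex by vertex. -/
def gridWord {n : ℕ} (vertex : Fin n → Vertex) : List Letter :=
  (List.ofFn vertex).flatMap Vertex.word

theorem bits_append_inj {a b : List Bool} {s t : List Letter}
    (hs : ∀ c, s.head? ≠ some (Letter.bit c)) (ht : ∀ c, t.head? ≠ some (Letter.bit c))
    (h : a.map Letter.bit ++ s = b.map Letter.bit ++ t) : a = b ∧ s = t := by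
  induction a generalizing b with
  | nil =>
    cases b with
    | nil => exact ⟨rfl, by simpa using h⟩
    | cons c b => exact absurd (by simp at h; simp [h]) (hs c)
  | cons c a ih =>
    cases b with
    | nil => exact absurd (by simp at h; simp [← h]) (ht c)
    | cons d b =>
      simp only [List.map_cons, List.cons_append, List.cons.injEq, Letter.bit.injEq] at h
      obtain ⟨h1, h2⟩ := ih h.2
      exact ⟨by rw [h.1, h1], h2⟩

theorem names_append_inj {l m : List (List Bool)} {s t : List Letter}
    (hs : s = [] ∨ ∃ f s', s = Letter.label f :: s')
    (ht : t = [] ∨ ∃ f t', t = Letter.label f :: t')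
    (h : l.flatMap (fun name => Letter.sep :: name.map Letter.bit) ++ s =
      m.flatMap (fun name => Letter.sep :: name.map Letter.bit) ++ t) : l = m ∧ s = t := by
  have key : ∀ (l : List (List Bool)) (s : List Letter),
      (s = [] ∨ ∃ f s', s = Letter.label f :: s') → ∀ c,
      (l.flatMap (fun name => Letter.sep :: name.map Letter.bit) ++ s).head? ≠
        some (Letter.bit c) := by
    intro l s hs c
    cases l with
    | nil => rcases hs with rfl | ⟨f, s', rfl⟩ <;> simp
    | cons a l => simp
  induction l generalizing m with
  | nil =>
    cases m with
    | nil => exact ⟨rfl, by simpa using h⟩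
    | cons a m => rcases hs with rfl | ⟨f, s', rfl⟩ <;> simp at h
  | cons a l ih =>
    cases m with
    | nil => rcases ht with rfl | ⟨f, t', rfl⟩ <;> simp at h
    | cons b m =>
      simp only [List.flatMap_cons, List.cons_append, List.cons.injEq, true_and,
        List.append_assoc] at h
      obtain ⟨h1, h2⟩ := bits_append_inj (key l s hs) (key m t ht) h
      obtain ⟨h3, h4⟩ := ih h2
      exact ⟨by rw [h1, h3], h4⟩

theorem vertices_word_inj {l m : List Vertex}
    (h : l.flatMap Vertex.word = m.flatMap Vertex.word) : l = m := by
  have key : ∀ l : List Vertex, l.flatMap Vertex.word = [] ∨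
      ∃ f s', l.flatMap Vertex.word = Letter.label f :: s' := by
    intro l
    cases l with
    | nil => exact Or.inl rfl
    | cons a l => exact Or.inr ⟨a.sig, _, rfl⟩
  induction l generalizing m with
  | nil =>
    cases m with
    | nil => rfl
    | cons b m => simp [Vertex.word] at h
  | cons a l ih =>
    cases m with
    | nil => simp [Vertex.word] at h
    | cons b m =>
      simp only [List.flatMap_cons, Vertex.word, List.cons_append, List.cons.injEq,
        Letter.label.injEq] at h
      obtain ⟨h1, h2⟩ := names_append_inj (key l) (key m) h.2
      obtain ⟨f, ea⟩ := a
      obtain ⟨g, eb⟩ := b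
      have h0 : f = g := h.1
      subst h0
      have h3 : ea = eb := List.ofFn_inj.mp h1
      rw [h3, ih h2]

theorem partitionFunction_eq_of_gridWord_eq {n m : ℕ} {x : Fin n → Vertex} {y : Fin m → Vertex}
    (h : gridWord x = gridWord y) : partitionFunction x = partitionFunction y := by
  have h1 := vertices_word_inj h
  have h2 : n = m := by simpa using congrArg List.length h1
  subst h2
  rw [List.ofFn_inj.mp h1]

/-- The problem `#EO(F)`: the input is a signature grid over `F`, the output is the value of its
partition function. -/
noncomputable def EOProblem (F : Set Signature) : CountingProblem where
  Instance := SignatureGrid F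
  word G := gridWord G.vertex
  value G := partitionFunction G.vertex
  value_eq_of_word_eq _ _ h := partitionFunction_eq_of_gridWord_eq h

/-! ### Oracle machines and polynomial-time Turing reductions

The machines are multi-stack machines (equivalently, multi-tape Turing machines) with an oracle,
presented as structured programs. They copy and compare symbols, and they do exact arithmetic with
complex numbers, with a logarithmic cost: each number is stored together with a length. Symbols in
the input word and constants in the program have length `1`, the result of an arithmetic
operation is longer than its two arguments together, and an answer of the oracle is as long as the
query. Thus, up to a constant factor, the length bounds the bit length of the number when it is
written down exactly as an element of the finitely generated field that contains the constants of
the program and the values of the (finitely many) signatures in use. Each instruction costs at least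
`1` plus the length of what it writes. -/

/-- A stack cell: a symbol and its length. -/
structure Cell where
  sym : Letter
  len : ℕ

/-- The contents of the stacks (the head of a list is the top of the stack). A program mentions
finitely many of them only. -/
abbrev Store : Type := ℕ → List Cell

/-- The field operations. -/
inductive ArithOp where
  | add
  | sub
  | mul
  | div

noncomputable def ArithOp.eval : ArithOp → ℂ → ℂ → ℂ
  | .add, x, y => x + y
  | .sub, x, y => x - y
  | .mul, x, y => x * y
  | .div, x, y => x / y

/-- The number that a symbol denotes; symbols that are not numbers count as `0`. -/
noncomputable def Letter.toComplex : Letter → ℂ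
  | .number z => z
  | _ => 0

/-- The number on top of stack `i`; an empty stack counts as `0`. -/
noncomputable def Store.topNumber (s : Store) (i : ℕ) : ℂ :=
  ((s i).head?.map fun c => c.sym.toComplex).getD 0

/-- The length of the symbol on top of stack `i`. -/
def Store.topLen (s : Store) (i : ℕ) : ℕ :=
  ((s i).head?.map Cell.len).getD 0

/-- The symbol on top of stack `i`, if there is one. -/
def Store.topLetter (s : Store) (i : ℕ) : Option Letter :=
  (s i).head?.map Cell.sym

/-- Put a cell on top of stack `i`. -/
def Store.push (s : Store) (i : ℕ) (c : Cell) : Store :=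
  Function.update s i (c :: s i)

/-- The conditions that a program can test. -/
inductive Test where
  /-- stack `i` is empty -/
  | empty (i : ℕ)
  /-- the symbol on top of stack `i` is the constant `a` -/
  | isConst (i : ℕ) (a : Letter)
  /-- the symbols on top of the stacks `i` and `j` are equal -/
  | same (i j : ℕ)

def Test.Holds : Test → Store → Prop
  | .empty i, s => s i = []
  | .isConst i a, s => s.topLetter i = some a
  | .same i j, s => s.topLetter i = s.topLetter j

def Test.cost : Test → Store → ℕ
  | .empty _, _ => 1
  | .isConst i _, s => 1 + s.topLen i
  | .same i j, s => 1 + s.topLen i + s.topLen j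

/-- Oracle programs. -/
inductive Program where
  /-- do nothing -/
  | skip
  /-- push the constant `a` on stack `i` -/
  | push (i : ℕ) (a : Letter)
  /-- remove the top of stack `i` -/
  | pop (i : ℕ)
  /-- push a copy of the top of stack `i` on stack `j` -/
  | copy (i j : ℕ)
  /-- push the result of an operation on the numbers on top of the stacks `i` and `j` on
  stack `k` -/
  | arith (o : ArithOp) (i j k : ℕ)
  /-- submit the word on stack `i` to the oracle and push its answer on stack `j` -/
  | query (i j : ℕ)
  | seq (P Q : Program)
  | cond (t : Test) (P Q : Program)
  /-- repeat `P` as long as `t` holds -/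
  | loop (t : Test) (P : Program)

/-- `P.Run O s n s'`: with an oracle for the problem `O`, the program `P`, started in the
store `s`, stops in the store `s'` after spending time `n`. The oracle has to be asked for
instances of `O`: any other query has no outcome. -/
inductive Program.Run (O : CountingProblem) : Program → Store → ℕ → Store → Prop where
  | skip (s : Store) : Run O .skip s 1 s
  | push (i : ℕ) (a : Letter) (s : Store) : Run O (.push i a) s 2 (s.push i ⟨a, 1⟩)
  | pop (i : ℕ) (s : Store) : Run O (.pop i) s 1 (Function.update s i (s i).tail)
  | copy (i j : ℕ) (s : Store) (c : Cell) (h : (s i).head? = some c) :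
      Run O (.copy i j) s (1 + c.len) (s.push j c)
  | copy_empty (i j : ℕ) (s : Store) (h : s i = []) : Run O (.copy i j) s 1 s
  | arith (o : ArithOp) (i j k : ℕ) (s : Store) :
      Run O (.arith o i j k) s (2 + s.topLen i + s.topLen j)
        (s.push k ⟨.number (o.eval (s.topNumber i) (s.topNumber j)),
          1 + s.topLen i + s.topLen j⟩)
  | query (i j : ℕ) (s : Store) (x : O.Instance) (h : (s i).map Cell.sym = O.word x) :
      Run O (.query i j) s (2 + (s i).length)
        (s.push j ⟨.number (O.value x), 1 + (s i).length⟩)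
  | seq {P Q : Program} {s s' s'' : Store} {m n : ℕ}
      (h : Run O P s m s') (h' : Run O Q s' n s'') : Run O (.seq P Q) s (m + n) s''
  | cond_true {t : Test} {P : Program} (Q : Program) {s s' : Store} {n : ℕ} (ht : t.Holds s)
      (h : Run O P s n s') : Run O (.cond t P Q) s (t.cost s + n) s'
  | cond_false {t : Test} (P : Program) {Q : Program} {s s' : Store} {n : ℕ} (ht : ¬ t.Holds s)
      (h : Run O Q s n s') : Run O (.cond t P Q) s (t.cost s + n) s'
  | loop_stop {t : Test} (P : Program) {s : Store} (ht : ¬ t.Holds s) :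
      Run O (.loop t P) s (t.cost s) s
  | loop_step {t : Test} {P : Program} {s s' s'' : Store} {m n : ℕ} (ht : t.Holds s)
      (h : Run O P s m s') (h' : Run O (.loop t P) s' n s'') :
      Run O (.loop t P) s (t.cost s + m + n) s''

/-- The initial store: the input word is on stack `0`, all the other stacks are empty. -/
def Store.init (w : List Letter) : Store :=
  fun i => if i = 0 then w.map (fun a => ⟨a, 1⟩) else []

/-- Polynomial-time Turing reducibility `A ≤_T B`: there is a program with an oracle for `B` that
stops on each instance of `A`, in time polynomial in the length of the input, with the value
of the instance on top of stack `0`. -/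
def PolyTimeTuringReducible (A B : CountingProblem) : Prop :=
  ∃ (P : Program) (p : Polynomial ℕ), ∀ x : A.Instance, ∃ (n : ℕ) (s : Store),
    P.Run B (Store.init (A.word x)) n s ∧ n ≤ p.eval (A.word x).length ∧
      s.topLetter 0 = some (.number (A.value x))

/-! ### Merging two variables of a function on 0-1 assignments -/

/-! Joining two variables of `f` by an edge, that is, summing over the strings with $x_i\neq x_j$,
gives an EO signature of arity $2n-2$ that inherits ARS. A vertex carrying it can be simulated by a
vertex carrying `f` with a loop, so every such signature may be added to `F`
(`polyTimeTuringReducible_joined`). What remains is to find a join outside $\mathcal{B}$;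
`mem_setB_of_joined` gives the contrapositive: if all joins of `f` lie in $\mathcal{B}$, so does
`f`.

Membership in $\mathcal{B}$ means that every variable has a partner in the sense of `HasFactor`
(`exists_hasFactor_of_mem_setB`, `mem_setB_of_hasFactor`). For a nonzero function, partner and ratio
are unique. ARS forces the ratios to have absolute value one and the remaining scalar to be real,
which is what binary factors with ARS need.

The core is `exists_hasFactor_of_merge`. Fix `u`, `v` with `merge u v f ≠ 0`; the other variables
are then paired by an involution `π`. Merge `i` and `j` from two different pairs. Since merges
commute, a pair `a`, `π a` that avoids `i` and `j` either persists in `merge i j f`, or its two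
members become partners of `u` and `v`; so at most one pair is destroyed. Comparing merges at
disjoint places shows that whether a pair is destroyed does not depend on `i` and `j`
(`not_factor_all`). Hence some pair is never destroyed. Its failure to be a factor of `f` itself is
measured by functions whose merges all vanish, and `eq_zero_of_triangle` kills these
(`hasFactor_of_crosses`). Once `f` has one factor on `a` and `b`, merging `a` with any `y` amounts
to renaming `y` to `b` up to scalars, so all other partners can be read off from the merge.

Arity at least ten is used twice: five pairs leave room for the auxiliary variables, and at least
five zeros and five ones in each support string leave both values outside any four variables. -/

namespace Assignment

variable {V : Type*} [DecidableEq V]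

/-- Overwrite the values of the variables `a` and `b`. -/
def set2 (α : V → Bool) (a : V) (x : Bool) (b : V) (y : Bool) : V → Bool :=
  Function.update (Function.update α a x) b y

/-- Join the variables `i` and `j` by an edge. The result no longer depends on them. -/
def merge (i j : V) (f : (V → Bool) → ℂ) (α : V → Bool) : ℂ :=
  f (set2 α i false j true) + f (set2 α i true j false)

/-- `f` is the product of a binary function of the variables `a` and `b`, which is supported on
`01` and `10` with ratio `r` of its values, and a function of the other variables. -/
structure HasFactor (a b : V) (r : ℂ) (f : (V → Bool) → ℂ) : Prop where
  ne : a ≠ b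
  ratio_ne : r ≠ 0
  diag : ∀ α x, f (set2 α a x b x) = 0
  off : ∀ α, f (set2 α a false b true) = r * f (set2 α a true b false)

theorem set2_comm {a b i j : V} (h1 : i ≠ a) (h2 : i ≠ b) (h3 : j ≠ a) (h4 : j ≠ b)
    (α : V → Bool) (x y z w : Bool) :
    set2 (set2 α a x b y) i z j w = set2 (set2 α i z j w) a x b y := by
  ext k; simp only [set2, Function.update_apply]; grind

theorem set2_symm {a b : V} (h : a ≠ b) (α : V → Bool) (x y : Bool) :
    set2 α a x b y = set2 α b y a x := by
  ext k; simp only [set2, Function.update_apply]; grind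

theorem set2_self (α : V → Bool) (a b : V) : set2 α a (α a) b (α b) = α := by
  ext k; simp only [set2, Function.update_apply]; grind

theorem merge_symm {i j : V} (h : i ≠ j) (f : (V → Bool) → ℂ) : merge i j f = merge j i f := by
  ext α; simp only [merge, set2_symm h]; ring

theorem merge_comm {a b i j : V} (h1 : i ≠ a) (h2 : i ≠ b) (h3 : j ≠ a) (h4 : j ≠ b)
    (f : (V → Bool) → ℂ) : merge a b (merge i j f) = merge i j (merge a b f) := by
  ext α; simp only [merge, set2_comm h1 h2 h3 h4]; ring

theorem merge_zero (i j : V) : merge i j (0 : (V → Bool) → ℂ) = 0 := by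
  ext α; simp [merge]

namespace HasFactor

variable {a b i j : V} {r s : ℂ} {f : (V → Bool) → ℂ}

theorem symm (h : HasFactor a b r f) : HasFactor b a r⁻¹ f where
  ne := h.ne.symm
  ratio_ne := inv_ne_zero h.ratio_ne
  diag α x := by rw [set2_symm h.ne.symm]; exact h.diag α x
  off α := by
    rw [set2_symm h.ne.symm, set2_symm h.ne.symm, h.off α, inv_mul_cancel_left₀ h.ratio_ne]

theorem eq_zero (h : HasFactor a b r f) {α : V → Bool} (e : α a = α b) : f α = 0 := by
  rw [← set2_self α a b, e]; exact h.diag α _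

theorem swap_ne_zero (h : HasFactor a b r f) {α : V → Bool} (hα : f α ≠ 0) :
    f (set2 α a (α b) b (α a)) ≠ 0 := by
  have h1 := h.off α
  have h2 := h.ratio_ne
  have h3 : α a ≠ α b := fun e => hα (h.eq_zero e)
  have h4 := set2_self α a b
  cases ha : α a <;> cases hb : α b <;> simp_all

theorem merge (h : HasFactor a b r f) (h1 : i ≠ a) (h2 : i ≠ b) (h3 : j ≠ a) (h4 : j ≠ b) :
    HasFactor a b r (merge i j f) where
  ne := h.ne
  ratio_ne := h.ratio_ne
  diag α x := by simp [Assignment.merge, set2_comm h1 h2 h3 h4, h.diag]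
  off α := by simp only [Assignment.merge, set2_comm h1 h2 h3 h4, h.off]; ring

/-- On a support string `b` and `b'` both differ from `a`, so they agree. Swapping the values at `a`
and `b` stays in the support, but then `a` agrees with `b'`. -/
theorem unique {b' : V} (h : HasFactor a b r f) (h' : HasFactor a b' s f) (hf : f ≠ 0) :
    b = b' := by
  by_contra hb
  obtain ⟨α, hα⟩ := Function.ne_iff.mp hf
  have h1 : α a ≠ α b := fun e => hα (h.eq_zero e)
  have h2 : α a ≠ α b' := fun e => hα (h'.eq_zero e)
  refine h.swap_ne_zero hα (h'.eq_zero ?_)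
  have h3 := h.ne
  have h4 := h'.ne
  have h5 : α b = α b' := by
    revert h1 h2; cases α a <;> cases α b <;> cases α b' <;> simp
  simp only [set2, Function.update_apply]
  grind

theorem ratio_unique (h : HasFactor a b r f) (h' : HasFactor a b s f) (hf : f ≠ 0) :
    r = s := by
  obtain ⟨α, hα⟩ := Function.ne_iff.mp hf
  have h1 : α a ≠ α b := fun e => hα (h.eq_zero e)
  have h2 := h.off α
  have h3 := h'.off α
  have h4 := h.swap_ne_zero hα
  have h5 := set2_self α a b
  have h6 : f (set2 α a true b false) ≠ 0 := by
    cases ha : α a <;> cases hb : α b <;> simp_all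
  exact mul_right_cancel₀ h6 (h2.symm.trans h3)

/-- No cancellation is possible. Some support string has different values at `i` and `j` (swap `a`
and `i` if necessary); exchanging these two values makes `i` agree with `a`, so the other summand is
zero. -/
theorem merge_ne_zero (h : HasFactor a i r f) (hf : f ≠ 0) (h1 : j ≠ a) (h2 : j ≠ i) :
    Assignment.merge i j f ≠ 0 := by
  obtain ⟨α, hα⟩ : ∃ α, f α ≠ 0 ∧ α i ≠ α j := by
    obtain ⟨α, hα⟩ := Function.ne_iff.mp hf
    by_cases e : α i = α j
    · refine ⟨_, h.swap_ne_zero hα, ?_⟩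
      have h3 : α a ≠ α i := fun e => hα (h.eq_zero e)
      have h4 := h.ne
      simp only [set2, Function.update_apply]
      grind
    · exact ⟨α, hα, e⟩
  have h3 : α a ≠ α i := fun e => hα.1 (h.eq_zero e)
  have h4 : f (set2 α i (α j) j (α i)) = 0 := by
    apply h.eq_zero
    have h4 := h.ne
    have h5 : α a = α j := by
      have h6 := hα.2
      revert h3 h6; cases α a <;> cases α i <;> cases α j <;> simp
    simp only [set2, Function.update_apply]
    grind
  have h5 := set2_self α i j
  intro e
  have h6 := congrFun e α
  have h7 := hα.2
  simp only [Assignment.merge, Pi.zero_apply] at h6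
  cases hi : α i <;> cases hj : α j <;> simp_all

end HasFactor

theorem neg_of_merge_eq_zero {i j : V} {h : (V → Bool) → ℂ} (hz : merge i j h = 0)
    {α : V → Bool} (hα : α i ≠ α j) : h (set2 α i (α j) j (α i)) = - h α := by
  have h1 := congrFun hz α
  have h2 := set2_self α i j
  simp only [merge, Pi.zero_apply] at h1
  cases hi : α i <;> cases hj : α j <;> simp_all
  · linear_combination h1
  · linear_combination h1

/-- Vanishing merges make `h` change sign under a swap of two differing values. When `i` and `j`
agree, the string with `i` and `k` swapped is reached by one such swap, and also by two (`j` with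
`k`, then `i` with `j`), so `h α = -h α`. -/
theorem eq_zero_of_triangle_aux {i j k : V} {h : (V → Bool) → ℂ} (hij : i ≠ j) (hik : i ≠ k)
    (hjk : j ≠ k) (h1 : merge i j h = 0) (h2 : merge i k h = 0) (h3 : merge j k h = 0)
    {α : V → Bool} (e : α i = α j) (hα : α i ≠ α k) : h α = 0 := by
  have e1 := neg_of_merge_eq_zero h3 (α := α) (by rwa [← e])
  have e2 := neg_of_merge_eq_zero h1 (α := set2 α j (α k) k (α j))
    (by simp only [set2, Function.update_apply]; grind)
  have e3 := neg_of_merge_eq_zero h2 (α := α) hα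
  have e4 : set2 (set2 α j (α k) k (α j)) i ((set2 α j (α k) k (α j)) j) j
      ((set2 α j (α k) k (α j)) i) = set2 α i (α k) k (α i) := by
    ext x; simp only [set2, Function.update_apply]; grind
  rw [e4, e3, e1] at e2
  have : (2 : ℂ) * h α = 0 := by linear_combination -e2
  simpa using this

/-- Among three bits two agree, so `k` agrees with `i` or with `j`, and the auxiliary lemma applies
after relabelling. -/
theorem eq_zero_of_triangle {i j k : V} {h : (V → Bool) → ℂ} (hij : i ≠ j) (hik : i ≠ k)
    (hjk : j ≠ k) (h1 : merge i j h = 0) (h2 : merge i k h = 0) (h3 : merge j k h = 0)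
    {α : V → Bool} (hα : α i ≠ α j) : h α = 0 := by
  by_cases e : α i = α k
  · exact eq_zero_of_triangle_aux hik hij hjk.symm h2 h1 (by rwa [merge_symm hjk.symm]) e hα
  · exact eq_zero_of_triangle_aux hjk hij.symm hik.symm h3 (by rwa [merge_symm hij.symm])
      (by rwa [merge_symm hik.symm])
      (by revert e hα; cases α i <;> cases α j <;> cases α k <;> simp)
      hα.symm

end Assignment

/-! ### Pairs of variables that survive all merges -/

namespace Assignment

variable {V : Type*} [DecidableEq V]

theorem exists_merge_ne_zero [Fintype V] (hV : 3 ≤ Fintype.card V) {f : (V → Bool) → ℂ}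
    (hf : f ≠ 0) (hbal : ∀ α, f α ≠ 0 → ∃ x y, α x ≠ α y) :
    ∃ u v, u ≠ v ∧ merge u v f ≠ 0 := by
  by_contra! hz
  obtain ⟨α, hα⟩ := Function.ne_iff.mp hf
  obtain ⟨x, y, hxy⟩ := hbal α hα
  have hne : x ≠ y := fun e => hxy (by rw [e])
  obtain ⟨z, -, hz'⟩ := Finset.exists_mem_notMem_of_card_lt_card (s := {x, y})
    (t := (Finset.univ : Finset V))
    (lt_of_le_of_lt Finset.card_le_two (by rw [Finset.card_univ]; omega))
  simp only [Finset.mem_insert, Finset.mem_singleton, not_or] at hz'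
  exact hα (eq_zero_of_triangle hne (Ne.symm hz'.1) (Ne.symm hz'.2) (hz _ _ hne)
    (hz _ _ (Ne.symm hz'.1)) (hz _ _ (Ne.symm hz'.2)) hxy)

/-- After `u` and `v` are merged, `f` is nonzero and all its other variables are paired up by `π`
with ratios `r`. -/
structure IsPairing (u v : V) (π : V → V) (r : V → ℂ) (f : (V → Bool) → ℂ) : Prop where
  ne : u ≠ v
  ne_zero : merge u v f ≠ 0
  factor : ∀ a, a ≠ u → a ≠ v → HasFactor a (π a) (r a) (merge u v f)
  ne_left : ∀ a, a ≠ u → a ≠ v → π a ≠ u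
  ne_right : ∀ a, a ≠ u → a ≠ v → π a ≠ v

/-- The variables `i` and `j` belong to different pairs. -/
def Crosses (u v : V) (π : V → V) (i j : V) : Prop :=
  i ≠ u ∧ i ≠ v ∧ j ≠ u ∧ j ≠ v ∧ i ≠ j ∧ j ≠ π i

/-- The pair of `a` is disjoint from `i` and `j`. -/
def Avoids (u v : V) (π : V → V) (i j a : V) : Prop :=
  a ≠ u ∧ a ≠ v ∧ i ≠ a ∧ i ≠ π a ∧ j ≠ a ∧ j ≠ π a

/-- After `u` and `v` are merged, the pairing is an involution. -/
theorem IsPairing.invol {u v : V} {π : V → V} {r : V → ℂ} {f : (V → Bool) → ℂ}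
    (P : IsPairing u v π r f) (a : V) (hu : a ≠ u) (hv : a ≠ v) : π (π a) = a :=
  (P.factor _ (P.ne_left a hu hv) (P.ne_right a hu hv)).unique (P.factor a hu hv).symm P.ne_zero

namespace IsPairing

variable {u v : V} {π : V → V} {r : V → ℂ} {f : (V → Bool) → ℂ} {i j k l a b : V}

theorem merge_merge_ne_zero (P : IsPairing u v π r f) (h : Crosses u v π i j) :
    merge u v (merge i j f) ≠ 0 := by
  obtain ⟨h1, h2, h3, h4, h5, h6⟩ := h
  rw [merge_comm h1 h2 h3 h4]
  exact (P.factor i h1 h2).symm.merge_ne_zero P.ne_zero h6 h5.symm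

theorem merge_ne_zero (P : IsPairing u v π r f) (h : Crosses u v π i j) : merge i j f ≠ 0 :=
  fun e => P.merge_merge_ne_zero h (by rw [e, merge_zero])

theorem merge_merge_factor (P : IsPairing u v π r f) (h : Crosses u v π i j)
    (ha : Avoids u v π i j a) : HasFactor a (π a) (r a) (merge u v (merge i j f)) := by
  obtain ⟨h1, h2, h3, h4, h5, h6⟩ := h
  obtain ⟨a1, a2, a3, a4, a5, a6⟩ := ha
  rw [merge_comm h1 h2 h3 h4]
  exact (P.factor a a1 a2).merge a3 a4 a5 a6

/-- If merging `i` and `j` destroys the factor of the pair of `a`, then `a` is paired with `u`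
or `v` instead. -/
theorem factor_or (P : IsPairing u v π r f)
    (H : ∀ i j, i ≠ j → ∀ a, a ≠ i → a ≠ j → ∃ b s, HasFactor a b s (merge i j f))
    (h : Crosses u v π i j) (ha : Avoids u v π i j a)
    (hbad : ¬ HasFactor a (π a) (r a) (merge i j f)) :
    ∃ w s, (w = u ∨ w = v) ∧ HasFactor a w s (merge i j f) := by
  obtain ⟨b, s, hb⟩ := H i j h.2.2.2.2.1 a ha.2.2.1.symm ha.2.2.2.2.1.symm
  refine ⟨b, s, ?_, hb⟩
  -- A partner `b` other than `u` and `v` would survive the merge of `u` and `v`, where uniqueness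
  -- forces both the partner `π a` and the ratio `r a`.
  by_contra! hw
  have h1 := hb.merge ha.1.symm hw.1.symm ha.2.1.symm hw.2.symm
  have h2 := P.merge_merge_factor h ha
  have h3 := P.merge_merge_ne_zero h
  obtain rfl := h1.unique h2 h3
  rw [h1.ratio_unique h2 h3] at hb
  exact hbad hb

theorem avoids_partner (P : IsPairing u v π r f) (ha : Avoids u v π i j a) :
    Avoids u v π i j (π a) := by
  have h1 := P.invol a
  have h2 := P.ne_left a
  have h3 := P.ne_right a
  unfold Avoids at *
  grind

theorem factor_of_partner (P : IsPairing u v π r f) (ha : a ≠ u) (hv : a ≠ v)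
    (h : HasFactor (π a) (π (π a)) (r (π a)) (merge i j f)) :
    HasFactor a (π a) (r a) (merge i j f) := by
  have h1 := P.factor _ (P.ne_left a ha hv) (P.ne_right a ha hv)
  rw [P.invol a ha hv] at h h1
  rw [(P.factor a ha hv).ratio_unique h1.symm P.ne_zero]
  exact h.symm

/-- At most one pair is destroyed: otherwise `a`, `π a` and `b` would be three variables with
distinct partners among `u` and `v`. -/
theorem factor_of_not_factor (P : IsPairing u v π r f)
    (H : ∀ i j, i ≠ j → ∀ a, a ≠ i → a ≠ j → ∃ b s, HasFactor a b s (merge i j f))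
    (h : Crosses u v π i j) (ha : Avoids u v π i j a) (hb : Avoids u v π i j b)
    (hab : b ≠ a) (hab' : b ≠ π a) (hbad : ¬ HasFactor a (π a) (r a) (merge i j f)) :
    HasFactor b (π b) (r b) (merge i j f) := by
  by_contra hbad'
  have hf := P.merge_ne_zero h
  obtain ⟨w, s, hw, hs⟩ := P.factor_or H h ha hbad
  obtain ⟨w', s', hw', hs'⟩ := P.factor_or H h (P.avoids_partner ha)
    fun e => hbad (P.factor_of_partner ha.1 ha.2.1 e)
  obtain ⟨w'', s'', hw'', hs''⟩ := P.factor_or H h hb hbad'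
  have h1 : w ≠ w' := by
    rintro rfl; exact (P.factor a ha.1 ha.2.1).ne (hs.symm.unique hs'.symm hf)
  have h2 : w ≠ w'' := by
    rintro rfl; exact hab (hs''.symm.unique hs.symm hf)
  have h3 : w' ≠ w'' := by
    rintro rfl; exact hab' (hs''.symm.unique hs'.symm hf)
  grind

/-- If the pair of `a` were destroyed by one merge and kept by the other, then after both merges `a`
would have two partners, one in `{u, v}` and the other `π a`. Both factors survive because the
merges commute, and the double merge is nonzero. -/
theorem not_factor_step (P : IsPairing u v π r f)
    (H : ∀ i j, i ≠ j → ∀ a, a ≠ i → a ≠ j → ∃ b s, HasFactor a b s (merge i j f))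
    (h : Crosses u v π i j) (ha : Avoids u v π i j a)
    (h' : Crosses u v π k l) (ha' : Avoids u v π k l a)
    (k1 : k ≠ i) (k2 : k ≠ j) (k3 : k ≠ π i) (k4 : k ≠ π j) (l1 : l ≠ i) (l2 : l ≠ j)
    (hbad : ¬ HasFactor a (π a) (r a) (merge i j f)) :
    ¬ HasFactor a (π a) (r a) (merge k l f) := by
  intro hgood
  obtain ⟨w, s, hw, hs⟩ := P.factor_or H h ha hbad
  obtain ⟨h1, h2, h3, h4, h5, h6⟩ := id h
  obtain ⟨h1', h2', h3', h4', h5', h6'⟩ := id h'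
  obtain ⟨a1, a2, a3, a4, a5, a6⟩ := id ha
  obtain ⟨a1', a2', a3', a4', a5', a6'⟩ := id ha'
  have e1 := hs.merge (i := k) (j := l) a3' (by grind) a5' (by grind)
  have e2 := hgood.merge a3 a4 a5 a6
  rw [merge_comm k1 k2 l1 l2] at e2
  -- It is nonzero even after merging `u` and `v` as well: the pair of `k` avoids `i` and `j`, so it
  -- is still a factor when `k` is merged with `l`.
  have hne : merge k l (merge i j f) ≠ 0 := by
    intro e
    have e3 : merge u v (merge k l (merge i j f)) = 0 := by rw [e, merge_zero]
    rw [merge_comm h1' h2' h3' h4', merge_comm h1 h2 h3 h4] at e3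
    have i1 := P.invol i h1 h2
    have i2 := P.invol j h3 h4
    have i3 := P.invol k h1' h2'
    have e4 := (P.factor k h1' h2').symm.merge (i := i) (j := j) (by grind) k1.symm (by grind)
      k2.symm
    refine e4.merge_ne_zero ?_ h6' h5'.symm e3
    rw [← merge_comm h1 h2 h3 h4]
    exact P.merge_merge_ne_zero h
  have := e1.unique e2 hne
  have := P.ne_left a a1 a2
  have := P.ne_right a a1 a2
  grind

end IsPairing

theorem exists_notMem_list [Fintype V] (L : List V) (h : L.length < Fintype.card V) :
    ∃ x, x ∉ L := by
  obtain ⟨z, -, hz⟩ := Finset.exists_mem_notMem_of_card_lt_card (s := L.toFinset)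
    (t := (Finset.univ : Finset V)) (lt_of_le_of_lt (List.toFinset_card_le L) (by simpa using h))
  exact ⟨z, by simpa using hz⟩

namespace IsPairing

variable {u v : V} {π : V → V} {r : V → ℂ} {f : (V → Bool) → ℂ} {i j k l a b : V}

/-- `not_factor_step` needs disjoint places, so the passage from `i, j` to `k, j` goes through a
third merge of a new variable `x` with `π j` or `π i`. Here `x` has to avoid nine variables, which
is where ten variables are needed. -/
theorem not_factor_replace [Fintype V] (hV : 10 ≤ Fintype.card V) (P : IsPairing u v π r f)
    (H : ∀ i j, i ≠ j → ∀ a, a ≠ i → a ≠ j → ∃ b s, HasFactor a b s (merge i j f))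
    (h : Crosses u v π i j) (ha : Avoids u v π i j a)
    (h' : Crosses u v π k j) (ha' : Avoids u v π k j a)
    (hbad : ¬ HasFactor a (π a) (r a) (merge i j f)) :
    ¬ HasFactor a (π a) (r a) (merge k j f) := by
  obtain ⟨x, hx⟩ := exists_notMem_list [u, v, a, π a, i, π i, j, π j, k]
    (lt_of_lt_of_le (by simp) hV)
  simp only [List.mem_cons, List.not_mem_nil, or_false, not_or] at hx
  have p1 := P.invol
  have p2 := P.ne_left
  have p3 := P.ne_right
  have p4 : ∀ a, a ≠ u → a ≠ v → a ≠ π a := fun a h h' => (P.factor a h h').ne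
  by_cases hk : k = π i
  · have c1 : Crosses u v π x (π j) := by unfold Crosses Avoids at *; grind
    have c2 : Avoids u v π x (π j) a := by unfold Crosses Avoids at *; grind
    have b1 := P.not_factor_step H h ha c1 c2 (by grind) (by grind) (by grind) (by grind)
      (by unfold Crosses Avoids at *; grind) (by unfold Crosses Avoids at *; grind) hbad
    refine P.not_factor_step H c1 c2 h' ha' ?_ ?_ ?_ ?_ ?_ ?_ b1 <;>
      (unfold Crosses Avoids at *; grind)
  · have c1 : Crosses u v π x (π i) := by unfold Crosses Avoids at *; grind
    have c2 : Avoids u v π x (π i) a := by unfold Crosses Avoids at *; grind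
    have b1 := P.not_factor_step H h ha c1 c2 (by grind) (by grind) (by grind) (by grind)
      (by unfold Crosses Avoids at *; grind) (by unfold Crosses Avoids at *; grind) hbad
    rw [merge_symm h'.2.2.2.2.1]
    refine P.not_factor_step H c1 c2 (k := j) (l := k) ?_ ?_ ?_ ?_ ?_ ?_ ?_ ?_ b1 <;>
      (unfold Crosses Avoids at *; grind)

/-- Two replacements suffice. The intermediate merge is of `k` with `j`, or of `l` with `j` when `k`
lies in the pair of `j`; in the latter case `l` does not lie there. -/
theorem not_factor_all [Fintype V] (hV : 10 ≤ Fintype.card V) (P : IsPairing u v π r f)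
    (H : ∀ i j, i ≠ j → ∀ a, a ≠ i → a ≠ j → ∃ b s, HasFactor a b s (merge i j f))
    (h : Crosses u v π i j) (ha : Avoids u v π i j a)
    (h' : Crosses u v π k l) (ha' : Avoids u v π k l a)
    (hbad : ¬ HasFactor a (π a) (r a) (merge i j f)) :
    ¬ HasFactor a (π a) (r a) (merge k l f) := by
  have p1 := P.invol
  have p4 : ∀ a, a ≠ u → a ≠ v → a ≠ π a := fun a h h' => (P.factor a h h').ne
  have flip : ∀ {i j}, Crosses u v π i j → Crosses u v π j i := by
    unfold Crosses; grind
  have flip' : ∀ {i j}, Avoids u v π i j a → Avoids u v π j i a := by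
    unfold Avoids; grind
  by_cases hk : k = j ∨ k = π j
  · have c1 : Crosses u v π l j := by unfold Crosses at *; grind
    have c2 : Avoids u v π l j a := by unfold Avoids at *; grind
    have b1 := P.not_factor_replace hV H h ha c1 c2 hbad
    rw [merge_symm c1.2.2.2.2.1] at b1
    exact P.not_factor_replace hV H (flip c1) (flip' c2) h' ha' b1
  · have c1 : Crosses u v π k j := by unfold Crosses at *; grind
    have c2 : Avoids u v π k j a := by unfold Avoids at *; grind
    have b1 := P.not_factor_replace hV H h ha c1 c2 hbad
    rw [merge_symm c1.2.2.2.2.1] at b1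
    rw [merge_symm h'.2.2.2.2.1]
    exact P.not_factor_replace hV H (flip c1) (flip' c2) (flip h') (flip' ha') b1

/-- There is a pair whose factor survives all merges of two variables of different other pairs. -/
theorem exists_factor_of_crosses [Fintype V] (hV : 10 ≤ Fintype.card V) (P : IsPairing u v π r f)
    (H : ∀ i j, i ≠ j → ∀ a, a ≠ i → a ≠ j → ∃ b s, HasFactor a b s (merge i j f)) :
    ∃ a, a ≠ u ∧ a ≠ v ∧ ∀ i j, Crosses u v π i j → Avoids u v π i j a →
      HasFactor a (π a) (r a) (merge i j f) := by
  by_contra! hall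
  obtain ⟨a, ha⟩ := exists_notMem_list [u, v] (lt_of_lt_of_le (by simp) hV)
  obtain ⟨b, hb⟩ := exists_notMem_list [u, v, a, π a] (lt_of_lt_of_le (by simp) hV)
  obtain ⟨x, hx⟩ := exists_notMem_list [u, v, a, π a, b, π b] (lt_of_lt_of_le (by simp) hV)
  obtain ⟨y, hy⟩ := exists_notMem_list [u, v, a, π a, b, π b, x, π x]
    (lt_of_lt_of_le (by simp) hV)
  simp only [List.mem_cons, List.not_mem_nil, or_false, not_or] at ha hb hx hy
  obtain ⟨i, j, h1, h2, h3⟩ := hall a ha.1 ha.2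
  obtain ⟨i', j', h1', h2', h3'⟩ := hall b hb.1 hb.2.1
  have c : Crosses u v π x y := by unfold Crosses; grind
  have ca : Avoids u v π x y a := by unfold Avoids; grind
  have cb : Avoids u v π x y b := by unfold Avoids; grind
  -- If every pair were destroyed somewhere, the merge of `x` and `y` would destroy both the pair of
  -- `a` and the pair of `b`.
  exact P.not_factor_all hV H h1' h2' c cb h3'
    (P.factor_of_not_factor H c ca cb hb.2.2.1 hb.2.2.2 (P.not_factor_all hV H h1 h2 c ca h3))

/-- Two differing values can be found in different pairs: if `x` and `y` are partners, any third
variable differs from one of them. A further variable `z` in yet another pair completes a triangle.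
-/
theorem eq_zero_of_crosses [Fintype V] (hV : 10 ≤ Fintype.card V) (P : IsPairing u v π r f)
    (ha : a ≠ u) (hv : a ≠ v) {h : (V → Bool) → ℂ}
    (hz : ∀ i j, Crosses u v π i j → Avoids u v π i j a → merge i j h = 0) {α : V → Bool}
    (hα : ∃ x y, (x ≠ u ∧ x ≠ v ∧ x ≠ a ∧ x ≠ π a) ∧ (y ≠ u ∧ y ≠ v ∧ y ≠ a ∧ y ≠ π a) ∧
      α x ≠ α y) : h α = 0 := by
  have p1 := P.invol
  have p2 := P.ne_left
  have p3 := P.ne_right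
  have p4 : ∀ a, a ≠ u → a ≠ v → a ≠ π a := fun a h h' => (P.factor a h h').ne
  obtain ⟨x, y, hx, hy, hxy, hc⟩ : ∃ x y, (x ≠ u ∧ x ≠ v ∧ x ≠ a ∧ x ≠ π a) ∧
      (y ≠ u ∧ y ≠ v ∧ y ≠ a ∧ y ≠ π a) ∧ α x ≠ α y ∧ y ≠ π x := by
    obtain ⟨x, y, hx, hy, hxy⟩ := hα
    by_cases hc : y = π x
    · obtain ⟨z, hz⟩ := exists_notMem_list [u, v, a, π a, x, y] (lt_of_lt_of_le (by simp) hV)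
      simp only [List.mem_cons, List.not_mem_nil, or_false, not_or] at hz
      by_cases e : α x = α z
      · exact ⟨y, z, by grind, by grind, by grind, by grind⟩
      · exact ⟨x, z, by grind, by grind, by grind, by grind⟩
    · exact ⟨x, y, hx, hy, hxy, hc⟩
  obtain ⟨z, hz'⟩ := exists_notMem_list [u, v, a, π a, x, y, π x, π y]
    (lt_of_lt_of_le (by simp) hV)
  simp only [List.mem_cons, List.not_mem_nil, or_false, not_or] at hz'
  have key : ∀ {i j}, (i ≠ u ∧ i ≠ v ∧ i ≠ a ∧ i ≠ π a) → (j ≠ u ∧ j ≠ v ∧ j ≠ a ∧ j ≠ π a) →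
      i ≠ j → j ≠ π i → merge i j h = 0 := fun {i j} h1 h2 h3 h4 =>
    hz i j ⟨h1.1, h1.2.1, h2.1, h2.2.1, h3, h4⟩
      ⟨ha, hv, h1.2.2.1, h1.2.2.2, h2.2.2.1, h2.2.2.2⟩
  have hne : x ≠ y := by grind
  exact eq_zero_of_triangle hne (k := z) (by grind) (by grind) (key hx hy hne hc)
    (key hx (by grind) (by grind) (by grind)) (key hy (by grind) (by grind) (by grind)) hxy

/-- A factor that survives all merges of two variables of different other pairs is a factor. -/
theorem hasFactor_of_crosses [Fintype V] (hV : 10 ≤ Fintype.card V) (P : IsPairing u v π r f)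
    (hbal : ∀ α, f α ≠ 0 → ∀ (c : Bool) (L : List V), L.length ≤ 4 → ∃ x, x ∉ L ∧ α x = c)
    (ha : a ≠ u) (hv : a ≠ v)
    (hgood : ∀ i j, Crosses u v π i j → Avoids u v π i j a →
      HasFactor a (π a) (r a) (merge i j f)) :
    HasFactor a (π a) (r a) f := by
  have hne := (P.factor a ha hv).ne
  have hbal' : ∀ α, f α ≠ 0 → ∃ x y, (x ≠ u ∧ x ≠ v ∧ x ≠ a ∧ x ≠ π a) ∧
      (y ≠ u ∧ y ≠ v ∧ y ≠ a ∧ y ≠ π a) ∧ α x ≠ α y := by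
    intro α hα
    obtain ⟨x, hx, hx'⟩ := hbal α hα true [u, v, a, π a] le_rfl
    obtain ⟨y, hy, hy'⟩ := hbal α hα false [u, v, a, π a] le_rfl
    simp only [List.mem_cons, List.not_mem_nil, or_false, not_or] at hx hy
    exact ⟨x, y, hx, hy, by simp [hx', hy']⟩
  -- Each condition of `HasFactor` says that a certain function of the other variables is zero. Its
  -- merges vanish by `hgood`, and it can be nonzero only on strings that take both values outside
  -- `u`, `v`, `a`, `π a`.
  refine ⟨hne, (P.factor a ha hv).ratio_ne, fun α x => ?_, fun α => ?_⟩
  · by_contra hα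
    refine hα ?_
    refine P.eq_zero_of_crosses hV ha hv (h := fun β => f (set2 β a x (π a) x)) ?_ (hbal' _ hα)
      |> Eq.trans ?_
    · congr 1; ext k; simp only [set2, Function.update_apply]; grind
    · intro i j hc hav
      ext β
      have := (hgood i j hc hav).diag β x
      obtain ⟨-, -, a3, a4, a5, a6⟩ := hav
      simp only [merge, set2_comm a3 a4 a5 a6] at this
      simpa [merge] using this
  · have key : (fun β => f (set2 β a false (π a) true) - r a * f (set2 β a true (π a) false)) α
        = 0 := by
      by_contra hα
      refine hα (P.eq_zero_of_crosses hV ha hv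
        (h := fun β => f (set2 β a false (π a) true) - r a * f (set2 β a true (π a) false)) ?_ ?_)
      · intro i j hc hav
        ext β
        have := (hgood i j hc hav).off β
        obtain ⟨-, -, a3, a4, a5, a6⟩ := hav
        simp only [merge, set2_comm a3 a4 a5 a6] at this
        simp only [merge, Pi.zero_apply]
        linear_combination this
      · have h1 : f (set2 α a false (π a) true) ≠ 0 ∨ f (set2 α a true (π a) false) ≠ 0 := by
          by_contra! h; simp [h] at hα
        rcases h1 with h1 | h1 <;> obtain ⟨x, y, hx, hy, hxy⟩ := hbal' _ h1 <;>
          refine ⟨x, y, hx, hy, ?_⟩ <;>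
          simpa [set2, Function.update_apply, hx, hy] using hxy
    exact sub_eq_zero.mp key

end IsPairing

/-! ### Reading off the factors of a function from a merge -/

theorem merge_set2 (i j : V) (f : (V → Bool) → ℂ) (α : V → Bool) (x y : Bool) :
    merge i j f (set2 α i x j y) = merge i j f α := by
  have : ∀ p q, set2 (set2 α i x j y) i p j q = set2 α i p j q := by
    intro p q; ext k; simp only [set2, Function.update_apply]; grind
  simp only [merge, this]

namespace HasFactor

variable {a b x y z : V} {r s : ℂ} {f : (V → Bool) → ℂ}

/-- Only one of the two summands gives `a` a value different from that of `b`, and it is `f β`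
itself. Thus such values of `f` are visible in the merge. -/
theorem merge_eq (h : HasFactor a b r f) (hya : y ≠ a) (hyb : y ≠ b) {β : V → Bool}
    (h1 : β a ≠ β b) (h2 : β y = β b) : Assignment.merge a y f β = f β := by
  have hab := h.ne
  have h3 := set2_self β a y
  cases hb : β b with
  | true =>
    have : f (set2 β a true y false) = 0 := h.eq_zero (by
      simp only [set2, Function.update_apply]; grind)
    simp_all [Assignment.merge]
  | false =>
    have : f (set2 β a false y true) = 0 := h.eq_zero (by
      simp only [set2, Function.update_apply]; grind)
    simp_all [Assignment.merge]

theorem eq_mul_swap (h : HasFactor a b r f) {β : V → Bool} (h1 : β a ≠ β b) :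
    f β = (if β a then r⁻¹ else r) * f (set2 β a (β b) b (β a)) := by
  have h2 := h.off β
  have h3 := h.symm.off β
  rw [set2_symm h.ne.symm, set2_symm h.ne.symm] at h3
  have h4 := set2_self β a b
  cases ha : β a <;> cases hb : β b <;> rw [ha, hb] at h4 <;> try exact absurd (ha.trans hb.symm) h1
  · rw [h4] at h2; simpa using h2
  · rw [h4] at h3; simpa using h3

/-- Every support string either satisfies the hypotheses of `merge_eq` or does so after `a` and `b`
are swapped. The swap multiplies the value by a scalar that does not depend on `x` and `z`. -/
theorem of_merge_of_ne (h : HasFactor a b r f) (hxa : x ≠ a) (hxb : x ≠ b) (hya : y ≠ a)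
    (hyb : y ≠ b) (hxy : x ≠ y) (hz : HasFactor x z s (Assignment.merge a y f)) (hza : z ≠ a)
    (hzy : z ≠ y) (hzb : z ≠ b) : HasFactor x z s f := by
  have hab := h.ne
  refine ⟨hz.ne, hz.ratio_ne, fun β p => ?_, fun β => ?_⟩
  · by_contra hγ
    have h1 : (set2 β x p z p) a ≠ (set2 β x p z p) b := fun e => hγ (h.eq_zero e)
    by_cases h2 : (set2 β x p z p) y = (set2 β x p z p) b
    · rw [← h.merge_eq hya hyb h1 h2] at hγ
      exact hγ (hz.diag _ _)
    · have h3 := h.swap_ne_zero hγ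
      rw [set2_comm hxa.symm hza.symm hxb.symm hzb.symm, ← h.merge_eq hya hyb] at h3
      · exact h3 (hz.diag _ _)
      · simp only [set2, Function.update_apply] at h1 ⊢; grind
      · revert h1 h2
        have : ∀ p q r : Bool, p ≠ q → ¬ r = q → r = p := by decide
        intro h1 h2
        have := this _ _ _ h1 h2
        simp only [set2, Function.update_apply] at this ⊢; grind
  · have va : ∀ p q, (set2 β x p z q) a = β a := fun p q => by
      simp only [set2, Function.update_apply]; grind
    have vb : ∀ p q, (set2 β x p z q) b = β b := fun p q => by
      simp only [set2, Function.update_apply]; grind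
    have vy : ∀ p q, (set2 β x p z q) y = β y := fun p q => by
      simp only [set2, Function.update_apply]; grind
    by_cases h1 : β a = β b
    · rw [h.eq_zero (by rw [va, vb, h1]), h.eq_zero (by rw [va, vb, h1]), mul_zero]
    by_cases h2 : β y = β b
    · rw [← h.merge_eq hya hyb (by rwa [va, vb]) (by rwa [vy, vb]),
        ← h.merge_eq hya hyb (by rwa [va, vb]) (by rwa [vy, vb]), hz.off]
    · have h3 : β y = β a := by
        revert h1 h2; generalize β a = p; generalize β b = q; generalize β y = t
        revert p q t; decide
      rw [h.eq_mul_swap (β := set2 β x false z true) (by rwa [va, vb]),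
        h.eq_mul_swap (β := set2 β x true z false) (by rwa [va, vb])]
      simp only [va, vb]
      have w : ∀ p q, f (set2 (set2 β x p z q) a (β b) b (β a)) =
          Assignment.merge a y f (set2 (set2 β a (β b) b (β a)) x p z q) := by
        intro p q
        rw [set2_comm hxa.symm hza.symm hxb.symm hzb.symm, h.merge_eq hya hyb] <;>
          (simp only [set2, Function.update_apply]; grind)
      rw [w, w, hz.off]; ring

/-- In the merge, `b` plays the part that `y` plays in `f`, so a partner `b` there is a partner `y`
here. The pair `a`, `b` contributes its own ratio to the merge, which has to be divided out. -/
theorem of_merge_of_eq (h : HasFactor a b r f) (hxa : x ≠ a) (hxb : x ≠ b) (hya : y ≠ a)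
    (hyb : y ≠ b) (hxy : x ≠ y) (hz : HasFactor x b s (Assignment.merge a y f)) :
    HasFactor x y (s / r) f := by
  have hab := h.ne
  refine ⟨hxy, div_ne_zero hz.ratio_ne h.ratio_ne, fun β p => ?_, fun β => ?_⟩
  · by_contra hγ
    have h1 : (set2 β x p y p) a ≠ (set2 β x p y p) b := fun e => hγ (h.eq_zero e)
    have hx : (set2 β x p y p) x = p := by simp only [set2, Function.update_apply]; grind
    have hy : (set2 β x p y p) y = p := by simp only [set2, Function.update_apply]; grind
    generalize set2 β x p y p = γ at *
    by_cases h2 : γ y = γ b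
    · rw [← h.merge_eq hya hyb h1 h2] at hγ
      exact hγ (hz.eq_zero (by rw [hx, ← hy, h2]))
    · have h3 := h.swap_ne_zero hγ
      have h4 : γ y = γ a := by
        revert h1 h2; generalize γ a = p; generalize γ b = q; generalize γ y = t
        revert p q t; decide
      rw [← h.merge_eq hya hyb] at h3
      · refine h3 (hz.eq_zero ?_)
        simp only [set2, Function.update_apply]; grind
      · simp only [set2, Function.update_apply]; grind
      · simp only [set2, Function.update_apply]; grind
  · have va : ∀ p q, (set2 β x p y q) a = β a := fun p q => by
      simp only [set2, Function.update_apply]; grind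
    have vb : ∀ p q, (set2 β x p y q) b = β b := fun p q => by
      simp only [set2, Function.update_apply]; grind
    have vy : ∀ p q, (set2 β x p y q) y = q := fun p q => by
      simp only [set2, Function.update_apply]; grind
    have hr := h.ratio_ne
    by_cases h1 : β a = β b
    · rw [h.eq_zero (by rw [va, vb, h1]), h.eq_zero (by rw [va, vb, h1]), mul_zero]
    have e1 : ∀ (p q t w : Bool), set2 (set2 (set2 β x p y t) x t b w) a q y p =
        set2 (set2 β x t y p) a q b w := by
      intro p q t w; ext k; simp only [set2, Function.update_apply]; grind
    have e2 : ∀ (p t : Bool), set2 (set2 β x p y t) a (β a) b (β b) = set2 β x p y t := by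
      intro p t; ext k; simp only [set2, Function.update_apply]; grind
    have e3 : ∀ (p t : Bool), set2 (set2 β x p y t) x p b (β b) = set2 β x p y t := by
      intro p t; ext k; simp only [set2, Function.update_apply]; grind
    -- In both cases one side of the identity is directly a value of the merge. The other becomes
    -- one after swapping `a` and `b`, and this swap brings in the ratio `r`.
    cases hb : β b with
    | true =>
      have ha : β a = false := by simpa [hb] using h1
      have g1 := h.merge_eq hya hyb (β := set2 β x false y true) (by rwa [va, vb])
        (by rw [vy, vb, hb])
      have g2 := hz.off (set2 β x false y true)
      have g3 := h.merge_eq hya hyb (β := set2 (set2 β x true y false) a true b false)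
        (by simp only [set2, Function.update_apply]; grind)
        (by simp only [set2, Function.update_apply]; grind)
      have g4 := h.off (set2 β x true y false)
      have g5 := merge_set2 a y f (set2 (set2 β x false y true) x true b false) true false
      have g6 := e2 true false
      have g7 := e3 false true
      rw [ha, hb] at g6
      rw [hb] at g7
      rw [e1, g3] at g5
      rw [g6] at g4
      rw [g7, g1, ← g5] at g2
      rw [g2, g4]; field_simp
    | false =>
      have ha : β a = true := by simpa [hb] using h1
      have g1 := h.merge_eq hya hyb (β := set2 β x true y false) (by rwa [va, vb])
        (by rw [vy, vb, hb])
      have g2 := hz.off (set2 β x true y false)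
      have g3 := h.merge_eq hya hyb (β := set2 (set2 β x false y true) a false b true)
        (by simp only [set2, Function.update_apply]; grind)
        (by simp only [set2, Function.update_apply]; grind)
      have g4 := h.off (set2 β x false y true)
      have g5 := merge_set2 a y f (set2 (set2 β x true y false) x false b true) false true
      have g6 := e2 false true
      have g7 := e3 true false
      rw [ha, hb] at g6
      rw [hb] at g7
      rw [e1, g3] at g5
      rw [g6] at g4
      rw [g7, g1, ← g5, g4] at g2
      field_simp
      linear_combination g2

end HasFactor

/-- If all variables are paired after any merge of two variables, then all variables are paired. -/
theorem exists_hasFactor_of_merge [Fintype V] (hV : 10 ≤ Fintype.card V) {f : (V → Bool) → ℂ}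
    (hf : f ≠ 0)
    (hbal : ∀ α, f α ≠ 0 → ∀ (c : Bool) (L : List V), L.length ≤ 4 → ∃ x, x ∉ L ∧ α x = c)
    (H : ∀ i j, i ≠ j → ∀ a, a ≠ i → a ≠ j →
      ∃ b s, b ≠ i ∧ b ≠ j ∧ HasFactor a b s (merge i j f)) (x : V) :
    ∃ y s, HasFactor x y s f := by
  obtain ⟨u, v, huv, h0⟩ := exists_merge_ne_zero (by omega) hf fun α hα => by
    obtain ⟨x, -, hx⟩ := hbal α hα true [] (by simp)
    obtain ⟨y, -, hy⟩ := hbal α hα false [] (by simp)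
    exact ⟨x, y, by simp [hx, hy]⟩
  have H0 : ∀ a, ∃ b s, a ≠ u → a ≠ v → b ≠ u ∧ b ≠ v ∧ HasFactor a b s (merge u v f) := by
    intro a
    by_cases h : a ≠ u ∧ a ≠ v
    · obtain ⟨b, s, h'⟩ := H u v huv a h.1 h.2
      exact ⟨b, s, fun _ _ => h'⟩
    · exact ⟨a, 0, fun h1 h2 => absurd ⟨h1, h2⟩ h⟩
  choose π r hπ using H0
  have P : IsPairing u v π r f := ⟨huv, h0, fun a h1 h2 => (hπ a h1 h2).2.2,
    fun a h1 h2 => (hπ a h1 h2).1, fun a h1 h2 => (hπ a h1 h2).2.1⟩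
  obtain ⟨a, ha, hv, hgood⟩ := P.exists_factor_of_crosses hV fun i j hij a h1 h2 => by
    obtain ⟨b, s, -, -, h⟩ := H i j hij a h1 h2
    exact ⟨b, s, h⟩
  have hfac := P.hasFactor_of_crosses hV hbal ha hv hgood
  by_cases hxa : x = a
  · exact ⟨_, _, hxa ▸ hfac⟩
  by_cases hxb : x = π a
  · exact ⟨_, _, hxb ▸ hfac.symm⟩
  -- The choice of `y` is free: merging it with `a` loses no information about `f`.
  obtain ⟨y, hy⟩ := exists_notMem_list [a, π a, x] (lt_of_lt_of_le (by simp) hV)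
  simp only [List.mem_cons, List.not_mem_nil, or_false, not_or] at hy
  obtain ⟨z, s, hza, hzy, hz⟩ := H a y (Ne.symm hy.1) x hxa (Ne.symm hy.2.2)
  by_cases hzb : z = π a
  · subst hzb
    exact ⟨_, _, hfac.of_merge_of_eq hxa hxb hy.1 hy.2.1 (Ne.symm hy.2.2) hz⟩
  · exact ⟨_, _, hfac.of_merge_of_ne hxa hxb hy.1 hy.2.1 (Ne.symm hy.2.2) hz hza hzy hzb⟩

end Assignment

namespace Assignment

/-! ### Products of binary signatures characterized by their factors -/

variable {V : Type*} [DecidableEq V]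

/-- A function on 0-1 assignments that is not changed by overwriting one value is constant. -/
theorem eq_of_update_eq {k : ℕ} {X : Type*} {ψ : (Fin k → Bool) → X}
    (h : ∀ t j b, ψ (Function.update t j b) = ψ t) (t t' : Fin k → Bool) : ψ t = ψ t' := by
  have : ∀ s : Finset (Fin k), ψ (s.piecewise t t') = ψ t' := by
    intro s
    induction s using Finset.induction_on with
    | empty => simp
    | insert j s _ ih => rw [Finset.piecewise_insert, h, ih]
  simpa using this Finset.univ

/-- A fixed-point free involution is the swap of the two columns of a two-column table. -/
theorem exists_table {m : ℕ} {π : Fin m → Fin m} (hinv : ∀ a, π (π a) = a) (hne : ∀ a, π a ≠ a) :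
    ∃ (k : ℕ) (e : Fin k × Fin 2 ≃ Fin m), ∀ j, π (e (j, 0)) = e (j, 1) := by
  let A := {a : Fin m // a < π a}
  let φ : Fin (Fintype.card A) ≃ A := (Fintype.equivFin A).symm
  let F : Fin (Fintype.card A) × Fin 2 → Fin m :=
    fun p => if p.2 = 0 then (φ p.1).1 else π (φ p.1).1
  have hF : Function.Bijective F := by
    constructor
    · rintro ⟨j, i⟩ ⟨j', i'⟩ h
      have h1 := (φ j).2
      have h2 := (φ j').2
      have h3 := hinv (φ j).1
      have h4 := hinv (φ j').1
      have key : (φ j).1 = (φ j').1 ∧ i = i' := by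
        revert h
        fin_cases i <;> fin_cases i' <;> simp only [F] <;> intro h
        · exact ⟨h, trivial⟩
        · exfalso; simp at h; rw [h, h4] at h1; exact absurd h1 (not_lt.mpr h2.le)
        · exfalso; simp at h; rw [← h, h3] at h2; exact absurd h2 (not_lt.mpr h1.le)
        · simp at h; exact ⟨by rw [← h3, h, h4], trivial⟩
      simpa [Subtype.ext_iff] using ⟨φ.injective (Subtype.ext key.1), key.2⟩
    · intro a
      rcases lt_or_gt_of_ne (hne a) with h | h
      · refine ⟨(φ.symm ⟨π a, by rwa [hinv]⟩, 1), ?_⟩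
        simp [F, hinv]
      · exact ⟨(φ.symm ⟨a, h⟩, 0), by simp [F]⟩
  exact ⟨_, Equiv.ofBijective F hF, fun j => by simp [F]⟩

end Assignment

namespace Signature

open Assignment

theorem wt_fin_two_ne {β : Fin 2 → Bool} (h : wt β = 1) : β 0 ≠ β 1 := by
  intro e
  have h' : (Finset.univ.filter fun i => β i = true).card = 1 := h
  rw [Finset.card_filter, Fin.sum_univ_two, ← e] at h'
  cases h0 : β 0 <;> simp [h0] at h'

theorem wt_fin_two_eq {β : Fin 2 → Bool} (h : β 0 ≠ β 1) : wt β = 1 := by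
  unfold wt
  rw [Finset.card_filter, Fin.sum_univ_two]
  cases h0 : β 0 <;> cases h1 : β 1 <;> simp_all

/-- Every variable of a product of binary EO signatures with arrow reversal symmetry belongs to a
binary factor. -/
theorem exists_hasFactor_of_mem_setB {f : Signature} (hf : f ∈ setB) (a : Fin f.arity) :
    ∃ b r, HasFactor a b r f.val := by
  obtain ⟨k, b, e, -, hb, hprod⟩ := hf
  have main : ∀ j, ∃ r, HasFactor (e (j, 0)) (e (j, 1)) r f.val := by
    intro j
    have hne : e (j, 0) ≠ e (j, 1) := fun h => by simpa using e.injective h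
    have hz : ∀ β : Fin 2 → Bool, β 0 = β 1 → b j β = 0 := by
      intro β hβ
      by_contra h
      obtain ⟨n, -, h2, h3⟩ := (hb j).1
      obtain rfl : n = 1 := by simp at h2; omega
      exact wt_fin_two_ne (h3 β h) hβ
    have hars := (hb j).2 ![true, false]
    have hc : (fun i => !(![true, false] : Fin 2 → Bool) i) = ![false, true] := by
      ext i; fin_cases i <;> rfl
    simp only [hc] at hars
    have hval : ∀ α x y, f.val (set2 α (e (j, 0)) x (e (j, 1)) y) =
        b j ![x, y] * ∏ j' ∈ Finset.univ.erase j, b j' fun i => α (e (j', i)) := by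
      intro α x y
      rw [hprod, ← Finset.mul_prod_erase _ _ (Finset.mem_univ j)]
      congr 1
      · congr 1; ext i; fin_cases i <;> simp [set2, hne]
      · refine Finset.prod_congr rfl fun j' hj' => ?_
        have : j' ≠ j := by simpa using hj'
        congr 1; ext i; simp [set2, this]
    have hdiag : ∀ α x, f.val (set2 α (e (j, 0)) x (e (j, 1)) x) = 0 := by
      intro α x; rw [hval, hz _ rfl, zero_mul]
    -- By ARS a factor that vanishes at `10` also vanishes at `01`; then any nonzero ratio will do.
    by_cases h0 : b j ![true, false] = 0
    · refine ⟨1, hne, one_ne_zero, hdiag, fun α => ?_⟩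
      rw [hval, hval, hars, h0]; simp
    · refine ⟨b j ![false, true] / b j ![true, false], hne, div_ne_zero ?_ h0, hdiag, fun α => ?_⟩
      · rw [hars]; simpa using h0
      · rw [hval, hval]; field_simp
  obtain ⟨⟨j, i⟩, rfl⟩ := e.surjective a
  obtain ⟨r, hr⟩ := main j
  fin_cases i
  · exact ⟨_, _, hr⟩
  · exact ⟨_, _, hr.symm⟩

/-- The binary signature with the values `c` at `01` and `d` at `10`. -/
def binary (c d : ℂ) (β : Fin 2 → Bool) : ℂ :=
  if β 0 = β 1 then 0 else if β 0 then d else c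

theorem isEO_binary (c d : ℂ) : IsEO ⟨2, binary c d⟩ := by
  refine ⟨1, one_pos, rfl, fun β hβ => wt_fin_two_eq fun e => hβ ?_⟩
  simp [binary, e]

theorem binary_not (c : ℂ) (β : Fin 2 → Bool) : binary c (starRingEnd ℂ c) (fun i => !(β i)) =
    starRingEnd ℂ (binary c (starRingEnd ℂ c) β) := by
  unfold binary
  by_cases h : β 0 = β 1
  · rw [if_pos h, if_pos (by simp [h]), map_zero]
  · rw [if_neg h, if_neg (by simpa using h)]
    by_cases h0 : β 0 = true <;> simp [h0]

theorem isARS_binary (c : ℂ) : IsARS ⟨2, binary c (starRingEnd ℂ c)⟩ :=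
  binary_not c

/-- An EO signature with arrow reversal symmetry, all of whose variables belong to binary
factors, is a product of binary EO signatures with arrow reversal symmetry. -/
theorem mem_setB_of_hasFactor {f : Signature} (hEO : f.IsEO) (hARS : f.IsARS)
    (h : ∀ a, ∃ b r, HasFactor a b r f.val) : f ∈ setB := by
  obtain ⟨n, hn, hm, -⟩ := hEO
  by_cases hf : f.val = 0
  · refine ⟨n, fun _ => binary 0 0, finProdFinEquiv.trans (finCongr (by omega)), hn, fun _ =>
      ⟨isEO_binary 0 0, by simpa using isARS_binary 0⟩, fun α => ?_⟩
    rw [hf]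
    exact (Finset.prod_eq_zero (Finset.mem_univ ⟨0, hn⟩) (by simp [binary])).symm
  choose π r hπ using h
  have hinv : ∀ a, π (π a) = a := fun a => (hπ _).unique (hπ a).symm hf
  obtain ⟨k, e, he⟩ := exists_table hinv fun a => (hπ a).ne.symm
  have hne : ∀ j, e (j, 0) ≠ e (j, 1) := fun j h => by simpa using e.injective h
  have hfac : ∀ j, HasFactor (e (j, 0)) (e (j, 1)) (r (e (j, 0))) f.val := fun j =>
    he j ▸ hπ (e (j, 0))
  have hk : 0 < k := by
    rcases Nat.eq_zero_or_pos k with rfl | h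
    · have := Fintype.card_congr e
      simp at this; omega
    · exact h
  -- the ratios have absolute value one
  have hc : ∀ j, ∃ c : ℂ, c ≠ 0 ∧ starRingEnd ℂ c = c⁻¹ ∧ c ^ 2 = r (e (j, 0)) := by
    intro j
    have hr := hfac j
    obtain ⟨α, hα⟩ := Function.ne_iff.mp hf
    set a := e (j, 0)
    set b := e (j, 1)
    have hab := hr.ne
    have h10 : f.val (set2 α a true b false) ≠ 0 := by
      have h1 : α a ≠ α b := fun e => hα (hr.eq_zero e)
      have h2 := hr.swap_ne_zero hα
      have h3 := set2_self α a b
      cases ha : α a <;> cases hb : α b <;> rw [ha, hb] at h2 h3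
      · exact absurd (ha.trans hb.symm) h1
      · exact h2
      · rwa [h3]
      · exact absurd (ha.trans hb.symm) h1
    have h1 := hr.off α
    have h2 := hr.off fun x => !(α x)
    have h3 := hARS (set2 α a true b false)
    have h4 := hARS (set2 α a false b true)
    have e1 : (fun i => !(set2 α a true b false) i) = set2 (fun x => !(α x)) a false b true := by
      ext x; simp only [set2, Function.update_apply]; grind
    have e2 : (fun i => !(set2 α a false b true) i) = set2 (fun x => !(α x)) a true b false := by
      ext x; simp only [set2, Function.update_apply]; grind
    rw [e1] at h3
    rw [e2, h1, map_mul] at h4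
    rw [h3, h4, ← mul_assoc, Complex.mul_conj] at h2
    have h5 : (Complex.normSq (r a) : ℂ) = 1 := by
      have : starRingEnd ℂ (f.val (set2 α a true b false)) ≠ 0 := by simpa using h10
      exact mul_right_cancel₀ this (by rw [← h2, one_mul])
    -- The square root spreads the ratio evenly: `c` at `01` and its conjugate, which is its
    -- inverse, at `10` have ratio `c ^ 2` and satisfy ARS.
    obtain ⟨c, hc⟩ := IsAlgClosed.exists_pow_nat_eq (r a) (n := 2) two_pos
    have hc0 : c ≠ 0 := by rintro rfl; exact hr.ratio_ne (by rw [← hc]; simp)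
    refine ⟨c, hc0, ?_, hc⟩
    have h6 : Complex.normSq c = 1 := by
      have h7 : Complex.normSq c ^ 2 = 1 := by
        rw [← map_pow, hc]; exact_mod_cast h5
      nlinarith [Complex.normSq_nonneg c]
    rw [Complex.inv_def, h6]; simp
  choose c hc0 hconj hsq using hc
  -- the assignment with given values at the first column of the table
  let asg : (Fin k → Bool) → Fin f.arity → Bool := fun t x =>
    if (e.symm x).2 = 0 then t (e.symm x).1 else !(t (e.symm x).1)
  have asg1 : ∀ t j, asg t (e (j, 1)) = !(t j) := fun t j => by simp [asg]
  -- These weights compensate the ratios: flipping one pair from `10` to `01` multiplies `f` by `c j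
  -- ^ 2` and the product of the weights by its inverse.
  let w : Fin k → Bool → ℂ := fun j b => if b then c j else (c j)⁻¹
  have hconst := eq_of_update_eq (ψ := fun t => f.val (asg t) * ∏ j, w j (t j)) (by
    intro t j b
    have e1 : ∀ b, asg (Function.update t j b) = set2 (asg t) (e (j, 0)) b (e (j, 1)) (!b) := by
      intro b; ext x
      obtain ⟨⟨j', i⟩, rfl⟩ := e.surjective x
      by_cases hj : j' = j
      · subst hj
        fin_cases i <;> simp [asg, set2, hne]
      · fin_cases i <;> simp [asg, set2, hj]
    have e2 : ∀ b, f.val (asg (Function.update t j b)) * ∏ j', w j' (Function.update t j b j') =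
        f.val (asg (Function.update t j true)) * ∏ j', w j' (Function.update t j true j') := by
      intro b
      cases b with
      | true => rfl
      | false =>
        rw [e1, e1, Bool.not_false, Bool.not_true, (hfac j).off,
          ← Finset.mul_prod_erase _ _ (Finset.mem_univ j),
          ← Finset.mul_prod_erase _ _ (Finset.mem_univ j)]
        have : ∀ b, ∏ j' ∈ Finset.univ.erase j, w j' (Function.update t j b j') =
            ∏ j' ∈ Finset.univ.erase j, w j' (t j') := fun b =>
          Finset.prod_congr rfl fun j' hj' => by
            rw [Function.update_of_ne (by simpa using hj')]
        rw [this, this, ← hsq]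
        simp only [Function.update_self, w]
        have := hc0 j
        simp only [Bool.false_eq_true, if_false, if_true]
        field_simp
    have e3 := e2 (t j)
    rw [Function.update_eq_self] at e3
    show f.val _ * _ = f.val _ * _
    rw [e2 b, e3])
  obtain ⟨lam, hlam⟩ : ∃ lam : ℂ, ∀ t, f.val (asg t) * ∏ j, w j (t j) = lam :=
    ⟨_, fun t => hconst t fun _ => true⟩
  have hval : ∀ t, f.val (asg t) = lam * ∏ j, w j (!(t j)) := by
    intro t
    rw [← hlam t, mul_assoc, ← Finset.prod_mul_distrib, Finset.prod_eq_one, mul_one]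
    intro j _
    have := hc0 j
    cases t j <;> simp [w, this]
  -- Apply ARS to two complementary strings; the products of weights are conjugate to each other, so
  -- they cancel.
  have hlamR : starRingEnd ℂ lam = lam := by
    have h1 := hARS (asg fun _ => true)
    have h2 : (fun i => !(asg (fun _ => true)) i) = asg fun _ => false := by
      ext x; simp only [asg]; split_ifs <;> rfl
    rw [h2, hval (fun _ => true), hval (fun _ => false), map_mul, map_prod] at h1
    have h3 : ∏ j, starRingEnd ℂ (w j (!true)) = ∏ j, w j (!false) :=
      Finset.prod_congr rfl fun j _ => by simp [w, hconj]
    rw [h3] at h1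
    refine (mul_right_cancel₀ ?_ h1).symm
    exact Finset.prod_ne_zero_iff.mpr fun j _ => by simp [w, hc0]
  -- The scalar goes into one of the factors; being real, it does not spoil ARS there.
  let μ : Fin k → ℂ := fun j => if j = ⟨0, hk⟩ then lam else 1
  have hμ : ∀ j, starRingEnd ℂ (μ j) = μ j := by
    intro j; simp only [μ]; split_ifs <;> simp [hlamR]
  refine ⟨k, fun j => binary (μ j * c j) (starRingEnd ℂ (μ j * c j)), e, hk, fun j =>
    ⟨isEO_binary _ _, isARS_binary _⟩, fun α => ?_⟩
  by_cases hα : ∃ j, α (e (j, 0)) = α (e (j, 1))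
  · obtain ⟨j, hj⟩ := hα
    rw [(hfac j).eq_zero hj, Finset.prod_eq_zero (Finset.mem_univ j)]
    simp [binary, hj]
  · push Not at hα
    have h1 : α = asg fun j => α (e (j, 0)) := by
      ext x
      obtain ⟨⟨j, i⟩, rfl⟩ := e.surjective x
      have := hα j
      fin_cases i
      · simp [asg]
      · simp only [Fin.mk_one, asg1]
        revert this; cases α (e (j, 0)) <;> cases α (e (j, 1)) <;> simp
    have h2 : ∀ j, binary (μ j * c j) (starRingEnd ℂ (μ j * c j)) (fun i => α (e (j, i))) =
        μ j * w j (!(α (e (j, 0)))) := by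
      intro j
      have := hα j
      simp only [binary, this, if_false, map_mul, hμ, hconj]
      cases α (e (j, 0)) <;> simp [w]
    rw [Finset.prod_congr rfl fun j _ => h2 j, Finset.prod_mul_distrib]
    have h3 : ∏ j, μ j = lam := by simp [μ]
    rw [h3, ← hval, ← h1]

/-! ### Joining two variables of a signature by an edge -/

/-- Sum over the two orientations of an edge that joins the variables `j` and `j.succAbove i`. -/
noncomputable def joinedVal {m : ℕ} (f : (Fin (m + 2) → Bool) → ℂ) (j : Fin (m + 2))
    (i : Fin (m + 1)) (β : Fin m → Bool) : ℂ :=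
  ∑ b : Bool, f (j.insertNth (!b) (i.insertNth b β : Fin (m + 1) → Bool))

/-- The signature obtained by joining the variables `j` and `j.succAbove i` by an edge. -/
noncomputable def joined {m : ℕ} (f : (Fin (m + 2) → Bool) → ℂ) (j : Fin (m + 2))
    (i : Fin (m + 1)) : Signature :=
  ⟨m, joinedVal f j i⟩

theorem wt_eq_sum {m : ℕ} (α : Fin m → Bool) : wt α = ∑ x, (α x).toNat := by
  unfold wt
  rw [Finset.card_filter]
  exact Finset.sum_congr rfl fun x _ => by cases α x <;> rfl

theorem wt_insertNth {m : ℕ} (j : Fin (m + 2)) (i : Fin (m + 1)) (b : Bool) (β : Fin m → Bool) :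
    wt (j.insertNth (!b) (i.insertNth b β : Fin (m + 1) → Bool) : Fin (m + 2) → Bool) =
      wt β + 1 := by
  simp only [wt_eq_sum, Fin.sum_univ_succAbove _ j, Fin.insertNth_apply_same,
    Fin.insertNth_apply_succAbove, Fin.sum_univ_succAbove _ i]
  cases b <;> simp <;> omega

variable {m : ℕ} {f : (Fin (m + 2) → Bool) → ℂ} (j : Fin (m + 2)) (i : Fin (m + 1))

theorem IsEO.joined (hf : IsEO ⟨m + 2, f⟩) (hm : 0 < m) : (joined f j i).IsEO := by
  obtain ⟨n, hn, h1, h2⟩ := hf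
  simp only at h1
  refine ⟨n - 1, by omega, by simp only [Signature.joined]; omega,
    fun (β : Fin m → Bool) (hβ : joinedVal f j i β ≠ 0) => ?_⟩
  obtain ⟨b, -, hb⟩ := Finset.exists_ne_zero_of_sum_ne_zero hβ
  have := h2 _ hb
  simp only [wt_insertNth] at this
  exact Nat.eq_sub_of_add_eq this

theorem joinedVal_not (hf : IsARS ⟨m + 2, f⟩) (β : Fin m → Bool) :
    joinedVal f j i (fun x => !(β x)) = starRingEnd ℂ (joinedVal f j i β) := by
  have key : ∀ (b : Bool) (β : Fin m → Bool),
      f (j.insertNth (!b) (i.insertNth b (fun x => !(β x)) : Fin (m + 1) → Bool)) =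
        starRingEnd ℂ (f (j.insertNth (!(!b)) (i.insertNth (!b) β : Fin (m + 1) → Bool))) := by
    intro b β
    rw [← hf]
    congr 1
    ext x
    refine Fin.succAboveCases j ?_ (fun x => ?_) x
    · simp
    · refine Fin.succAboveCases i ?_ (fun x => ?_) x <;> simp
  simp only [joinedVal, Fintype.sum_bool, map_add, key, Bool.not_true, Bool.not_false]
  rw [add_comm]

theorem IsARS.joined (hf : IsARS ⟨m + 2, f⟩) : (joined f j i).IsARS :=
  joinedVal_not j i hf

/-- This translates between the two forms of a join: `merge` keeps the set of variables fixed, which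
suits commuting merges, while `joinedVal` has the smaller arity. -/
theorem merge_eq_joined (α : Fin (m + 2) → Bool) :
    merge (j.succAbove i) j f α =
      joinedVal f j i fun x => α (j.succAbove (i.succAbove x)) := by
  have key : ∀ b, set2 α (j.succAbove i) b j (!b) = j.insertNth (!b)
      (i.insertNth b (fun x => α (j.succAbove (i.succAbove x))) : Fin (m + 1) → Bool) := by
    intro b
    ext x
    refine Fin.succAboveCases j ?_ (fun x => ?_) x
    · simp [set2]
    · refine Fin.succAboveCases i ?_ (fun x => ?_) x <;> simp [set2]
  simp only [merge, joinedVal, Fintype.sum_bool, ← key]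
  rw [add_comm]; rfl

theorem hasFactor_merge {a b : Fin m} {r : ℂ} (h : HasFactor a b r (joinedVal f j i)) :
    HasFactor (j.succAbove (i.succAbove a)) (j.succAbove (i.succAbove b)) r
      (merge (j.succAbove i) j f) := by
  have key : ∀ α x y, (fun z => set2 α (j.succAbove (i.succAbove a)) x
      (j.succAbove (i.succAbove b)) y (j.succAbove (i.succAbove z))) =
      set2 (fun z => α (j.succAbove (i.succAbove z))) a x b y := by
    intro α x y; ext z; simp [set2, Function.update_apply]
  refine ⟨by simpa using h.ne, h.ratio_ne, fun α x => ?_, fun α => ?_⟩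
  · rw [merge_eq_joined, key]; exact h.diag _ _
  · rw [merge_eq_joined, merge_eq_joined, key, key]; exact h.off _

/-- An EO signature of arity at least ten with arrow reversal symmetry is a product of binary
signatures if all signatures obtained by joining two of its variables are. -/
theorem mem_setB_of_joined (hEO : IsEO ⟨m + 2, f⟩) (hARS : IsARS ⟨m + 2, f⟩) (hm : 10 ≤ m + 2)
    (h : ∀ (j : Fin (m + 2)) (i : Fin (m + 1)), i.castSucc < j → joined f j i ∈ setB) :
    (⟨m + 2, f⟩ : Signature) ∈ setB := by
  by_cases hf : f = 0
  · refine mem_setB_of_hasFactor hEO hARS fun a => ?_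
    obtain ⟨b, hb⟩ := exists_notMem_list [a] (by simp)
    exact ⟨b, 1, by simpa [eq_comm] using hb, one_ne_zero, by simp [hf], by simp [hf]⟩
  refine mem_setB_of_hasFactor hEO hARS fun a => ?_
  refine exists_hasFactor_of_merge (by simpa using hm) hf ?_ ?_ a
  · intro α hα c L hL
    obtain ⟨n, hn, h1, h2⟩ := hEO
    have h3 : wt α = n := h2 α hα
    simp only at h1
    -- Half of the variables have each value, and the arity is at least ten; five exceeds the length
    -- of `L`.
    have h4 : 5 ≤ (Finset.univ.filter fun x => α x = c).card := by
      have h5 := Finset.card_filter_add_card_filter_not (s := Finset.univ) (fun x => α x = true)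
      unfold wt at h3
      rw [h3, Finset.card_univ, Fintype.card_fin] at h5
      cases c with
      | true => rw [h3]; omega
      | false => simp only [Bool.not_eq_true] at h5; omega
    obtain ⟨x, hx, hx'⟩ := Finset.exists_mem_notMem_of_card_lt_card (s := L.toFinset)
      (t := Finset.univ.filter fun x => α x = c)
      (lt_of_le_of_lt (List.toFinset_card_le L) (by omega))
    exact ⟨x, by simpa using hx', by simpa using hx⟩
  · have main : ∀ x y : Fin (m + 2), x < y → ∀ a, a ≠ x → a ≠ y →
        ∃ b s, b ≠ x ∧ b ≠ y ∧ HasFactor a b s (merge x y f) := by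
      intro x y hxy a hx hy
      have hx' : (x.castLT (by omega)).castSucc = x := rfl
      have hxa : y.succAbove (x.castLT (by omega)) = x := by
        rw [Fin.succAbove_of_castSucc_lt _ _ hxy, hx']
      obtain ⟨a', rfl⟩ := Fin.exists_succAbove_eq hy
      obtain ⟨a'', rfl⟩ := Fin.exists_succAbove_eq (x := a') (y := x.castLT (by omega))
        (by rintro rfl; exact hx hxa)
      obtain ⟨b, r, hb⟩ : ∃ (b : Fin m) (r : ℂ),
          HasFactor a'' b r (joinedVal f y (x.castLT (by omega))) :=
        exists_hasFactor_of_mem_setB (h y (x.castLT (by omega)) hxy) a''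
      refine ⟨_, _, ?_, ?_, by simpa only [hxa] using hasFactor_merge _ _ hb⟩
      · intro e
        exact Fin.succAbove_ne _ _ (Fin.succAbove_right_injective (e.trans hxa.symm))
      · exact Fin.succAbove_ne _ _
    intro x y hxy a hx hy
    rcases lt_or_gt_of_ne hxy with hlt | hlt
    · exact main x y hlt a hx hy
    · obtain ⟨b, s, h1, h2, h3⟩ := main y x hlt a hy hx
      exact ⟨b, s, h2, h1, by rwa [merge_symm hxy]⟩

end Signature

/-! ### Replacing vertices of a signature grid by small gadgets -/

/-- The name of the additional edge at the `c`-th vertex. -/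
def freshName (c : ℕ) : List Bool :=
  true :: List.replicate c true

theorem freshName_injective : Function.Injective freshName := fun a b h => by
  simpa [freshName] using congrArg List.length h

/-- The variables of `f'` are those of `f`, with the same edges, and possibly two additional ones
that are joined by an edge with the name `freshName c`. Summing over the orientations of this edge
turns `f'` into `f`. -/
def RefinesVal {m m' : ℕ} (c : ℕ) (f' : (Fin m' → Bool) → ℂ) (edge' : Fin m' → List Bool)
    (f : (Fin m → Bool) → ℂ) (edge : Fin m → List Bool) : Prop :=
  ∃ ι : Fin m → Fin m', Function.Injective ι ∧
    (∀ k, edge' (ι k) = false :: edge k) ∧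
    (∀ k, k ∉ Set.range ι → edge' k = freshName c) ∧
    (∀ p, p ∉ Set.range ι → ∃! q, q ≠ p ∧ q ∉ Set.range ι) ∧
    open Classical in ∀ x, f x = ∑ y ∈ Finset.univ.filter fun y =>
      (∀ p q, p ∉ Set.range ι → q ∉ Set.range ι → p ≠ q → y p ≠ y q) ∧ (fun k => y (ι k)) = x,
      f' y

/-- The vertex `w` has the edge ends of `v`, and possibly a loop with the name `freshName c`, and
the signature of `v` arises from that of `w` by this loop. -/
def Vertex.Refines (c : ℕ) (w v : Vertex) : Prop :=
  RefinesVal c w.sig.val w.edge v.sig.val v.edge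

/-- Old names begin with `false` and fresh names with `true`, and fresh names of different vertices
differ. So no edge joins an old end to a new one, and the new edges are loops with independent
constraints. -/
theorem isOrientation_refines {n : ℕ} {w v : Fin n → Vertex}
    {ι : ∀ k, Fin (v k).sig.arity → Fin (w k).sig.arity} (hι : ∀ k, Function.Injective (ι k))
    (hold : ∀ k x, (w k).edge (ι k x) = false :: (v k).edge x)
    (hnew : ∀ k x, x ∉ Set.range (ι k) → (w k).edge x = freshName k)
    (σ : EdgeEnd w → Bool) :
    IsOrientation w σ ↔
      (∀ k p q, p ∉ Set.range (ι k) → q ∉ Set.range (ι k) → p ≠ q → σ ⟨k, p⟩ ≠ σ ⟨k, q⟩) ∧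
      IsOrientation v fun p => σ ⟨p.1, ι p.1 p.2⟩ := by
  constructor
  · intro h
    refine ⟨fun k p q hp hq hpq => h _ _ (by simpa using hpq) ?_, fun p q hpq he => h _ _ ?_ ?_⟩
    · simp [edgeOf, hnew _ _ hp, hnew _ _ hq]
    · obtain ⟨k, x⟩ := p
      obtain ⟨l, y⟩ := q
      intro e
      obtain rfl : k = l := congrArg Sigma.fst e
      simp only [Sigma.mk.injEq, heq_eq_eq, true_and] at e
      exact hpq (by rw [hι _ e])
    · simpa [edgeOf, hold] using he
  · rintro ⟨h1, h2⟩ ⟨k, x⟩ ⟨l, y⟩ hpq he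
    simp only [edgeOf] at he
    by_cases hx : x ∈ Set.range (ι k) <;> by_cases hy : y ∈ Set.range (ι l)
    · obtain ⟨x, rfl⟩ := hx
      obtain ⟨y, rfl⟩ := hy
      refine h2 ⟨k, x⟩ ⟨l, y⟩ ?_ (by simpa [edgeOf, hold] using he)
      intro e
      obtain rfl : k = l := congrArg Sigma.fst e
      simp only [Sigma.mk.injEq, heq_eq_eq, true_and] at e
      exact hpq (by rw [e])
    · obtain ⟨x, rfl⟩ := hx
      rw [hold, hnew _ _ hy] at he
      simp [freshName] at he
    · obtain ⟨y, rfl⟩ := hy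
      rw [hold, hnew _ _ hx] at he
      simp [freshName] at he
    · rw [hnew _ _ hx, hnew _ _ hy] at he
      obtain rfl : k = l := Fin.ext (freshName_injective he)
      exact h1 k x y hx hy fun e => hpq (by rw [e])

-- The balance condition may be dropped, because an EO signature vanishes on unbalanced strings. The
-- remaining condition concerns edges only, and the summands factor over the vertices.
open Classical in
theorem partitionFunction_eq_sum_isOrientation {n : ℕ} {v : Fin n → Vertex}
    (h : ∀ k, (v k).sig.IsEO) : partitionFunction v =
      ∑ σ ∈ Finset.univ.filter fun σ : ∀ k, Fin (v k).sig.arity → Bool =>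
        IsOrientation v fun p => σ p.1 p.2, ∏ k, (v k).sig.val (σ k) := by
  have h1 : partitionFunction v = ∑ σ ∈ Finset.univ.filter (IsOrientation v),
      ∏ k, (v k).sig.val (fun i => σ ⟨k, i⟩) := by
    refine Finset.sum_subset (fun σ hσ => ?_) fun σ hσ hσ' => ?_
    · simp only [Finset.mem_filter, Finset.mem_univ, true_and] at hσ ⊢
      exact hσ.1
    · simp only [Finset.mem_filter, Finset.mem_univ, true_and] at hσ hσ'
      by_contra hne
      refine hσ' ⟨hσ, fun k => ?_⟩
      obtain ⟨n, -, h2, h3⟩ := h k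
      have h4 : (Finset.univ.filter fun i => σ ⟨k, i⟩ = true).card = n :=
        h3 _ (Finset.prod_ne_zero_iff.mp hne k (Finset.mem_univ k))
      have h5 := Finset.card_filter_add_card_filter_not (s := Finset.univ)
        (fun i => σ ⟨k, i⟩ = true)
      rw [h4, Finset.card_univ, Fintype.card_fin] at h5
      have h6 := h5.trans h2
      simp only [Bool.not_eq_true] at h6
      rw [h4]; omega
  rw [h1]
  refine Finset.sum_equiv (Equiv.piCurry fun _ _ => Bool) (fun σ => ?_) fun σ _ => rfl
  simp only [Finset.mem_filter, Finset.mem_univ, true_and]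
  rfl

/-- Group the orientations of the finer grid by their restriction to the old edges. Within a group
the loops are oriented independently, so the sum of products is the product over the vertices of the
sums in `RefinesVal`. -/
theorem partitionFunction_eq_of_refines {n : ℕ} {w v : Fin n → Vertex}
    (h : ∀ k : Fin n, (w k).Refines k (v k)) (hw : ∀ k, (w k).sig.IsEO)
    (hv : ∀ k, (v k).sig.IsEO) : partitionFunction v = partitionFunction w := by
  classical
  choose ι hι hold hnew htwo hval using h
  rw [partitionFunction_eq_sum_isOrientation hv, partitionFunction_eq_sum_isOrientation hw]
  rw [← Finset.sum_fiberwise_of_maps_to (t := Finset.univ.filter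
    fun σ : ∀ k, Fin (v k).sig.arity → Bool => IsOrientation v fun p => σ p.1 p.2)
    (g := fun (τ : ∀ k, Fin (w k).sig.arity → Bool) k x => τ k (ι k x))]
  · refine Finset.sum_congr rfl fun σ hσ => ?_
    rw [Finset.prod_congr rfl fun k _ => hval k (σ k), Finset.prod_univ_sum]
    refine Finset.sum_congr ?_ fun _ _ => rfl
    ext τ
    simp only [Finset.mem_filter, Finset.mem_univ, true_and, Fintype.mem_piFinset] at hσ ⊢
    rw [isOrientation_refines hι hold hnew]
    constructor
    · intro h
      have e : (fun k x => τ k (ι k x)) = σ := funext fun k => (h k).2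
      refine ⟨⟨fun k => (h k).1, ?_⟩, e⟩
      simp only [← e] at hσ
      exact hσ
    · rintro ⟨⟨h1, -⟩, h2⟩ k
      exact ⟨h1 k, congrFun h2 k⟩
  · intro τ hτ
    simp only [Finset.mem_filter, Finset.mem_univ, true_and] at hτ ⊢
    exact ((isOrientation_refines hι hold hnew fun p => τ p.1 p.2).mp hτ).2

/-- The marks keep the two kinds of names apart: an old end keeps its old mate, and the mate of a
new end is the other new end at the same vertex. -/
theorem two_ends_of_refines {n : ℕ} {w v : Fin n → Vertex}
    (h : ∀ k : Fin n, (w k).Refines k (v k))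
    (hv : ∀ p : EdgeEnd v, ∃! q : EdgeEnd v, q ≠ p ∧ edgeOf v q = edgeOf v p) (p : EdgeEnd w) :
    ∃! q : EdgeEnd w, q ≠ p ∧ edgeOf w q = edgeOf w p := by
  choose ι hι hold hnew htwo hval using h
  obtain ⟨k, x⟩ := p
  by_cases hx : x ∈ Set.range (ι k)
  · obtain ⟨x, rfl⟩ := hx
    obtain ⟨⟨l, y⟩, ⟨h1, h2⟩, h3⟩ := hv ⟨k, x⟩
    refine ⟨⟨l, ι l y⟩, ⟨?_, by simpa [edgeOf, hold] using h2⟩, ?_⟩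
    · intro e
      obtain rfl : l = k := congrArg Sigma.fst e
      simp only [Sigma.mk.injEq, heq_eq_eq, true_and] at e
      exact h1 (by rw [hι _ e])
    · rintro ⟨l', z⟩ ⟨h4, h5⟩
      by_cases hz : z ∈ Set.range (ι l')
      · obtain ⟨z, rfl⟩ := hz
        have := h3 ⟨l', z⟩ ⟨fun e => h4 ?_, by simpa [edgeOf, hold] using h5⟩
        · obtain rfl : l' = l := congrArg Sigma.fst this
          simp only [Sigma.mk.injEq, heq_eq_eq, true_and] at this
          rw [this]
        · obtain rfl : l' = k := congrArg Sigma.fst e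
          simp only [Sigma.mk.injEq, heq_eq_eq, true_and] at e
          rw [e]
      · simp [edgeOf, hold, hnew _ _ hz, freshName] at h5
  · obtain ⟨y, ⟨h1, h2⟩, h3⟩ := htwo k x hx
    refine ⟨⟨k, y⟩, ⟨by simpa using h1, by simp [edgeOf, hnew _ _ hx, hnew _ _ h2]⟩, ?_⟩
    rintro ⟨l, z⟩ ⟨h4, h5⟩
    by_cases hz : z ∈ Set.range (ι l)
    · obtain ⟨z, rfl⟩ := hz
      simp [edgeOf, hold, hnew _ _ hx, freshName] at h5
    · simp only [edgeOf, hnew _ _ hx, hnew _ _ hz] at h5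
      obtain rfl : l = k := Fin.ext (freshName_injective h5)
      rw [h3 z ⟨fun e => h4 (by rw [e]), hz⟩]

namespace Vertex

open Signature

/-- Mark the old edges. -/
def mark (v : Vertex) : Vertex :=
  ⟨v.sig, fun k => false :: v.edge k⟩

theorem refines_mark (c : ℕ) (v : Vertex) : v.mark.Refines c v := by
  have : ∀ {m : ℕ} (f : (Fin m → Bool) → ℂ) (edge : Fin m → List Bool),
      RefinesVal c f (fun k => false :: edge k) f edge := by
    intro m f edge
    refine ⟨id, Function.injective_id, fun k => rfl, fun k hk => absurd ⟨k, rfl⟩ hk,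
      fun k hk => absurd ⟨k, rfl⟩ hk, fun x => ?_⟩
    rw [Finset.sum_eq_single_of_mem x]
    · simp
    · intro y hy hne
      simp only [Finset.mem_filter] at hy
      exact absurd hy.2.2 hne
  exact this _ _

/-- The edge names at a vertex with an additional loop at the variables `j` and
`j.succAbove i`. -/
def loopEdge {m : ℕ} (j : Fin (m + 2)) (i : Fin (m + 1)) (name : List Bool)
    (edge : Fin m → List Bool) : Fin (m + 2) → List Bool :=
  j.insertNth name (i.insertNth name (fun k => false :: edge k) : Fin (m + 1) → List Bool)

/-- A vertex with a loop at the variables `j` and `j.succAbove i`. -/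
def addLoop {m : ℕ} (f : (Fin (m + 2) → Bool) → ℂ) (j : Fin (m + 2)) (i : Fin (m + 1))
    (name : List Bool) (edge : Fin m → List Bool) : Vertex :=
  ⟨⟨m + 2, f⟩, loopEdge j i name edge⟩

theorem refinesVal_loopEdge {m : ℕ} (f : (Fin (m + 2) → Bool) → ℂ) (j : Fin (m + 2))
    (i : Fin (m + 1)) (c : ℕ) (edge : Fin m → List Bool) :
    RefinesVal c f (loopEdge j i (freshName c) edge) (joinedVal f j i) edge := by
  let ι : Fin m → Fin (m + 2) := fun k => j.succAbove (i.succAbove k)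
  have hr : ∀ x, x ∉ Set.range ι ↔ x = j ∨ x = j.succAbove i := by
    intro x
    refine Fin.succAboveCases j ?_ (fun x => ?_) x
    · simp [ι]
    · refine Fin.succAboveCases i ?_ (fun x => ?_) x
      · simp [ι]
      · simp [ι]
  have hj : j.succAbove i ≠ j := Fin.succAbove_ne j i
  refine ⟨ι, fun x y h => ?_, fun k => ?_, fun k hk => ?_, fun k hk => ?_, fun x => ?_⟩
  · exact Fin.succAbove_right_injective (Fin.succAbove_right_injective h)
  · simp [loopEdge, ι]
  · rcases (hr k).mp hk with rfl | rfl <;> simp [loopEdge]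
  · rcases (hr k).mp hk with rfl | rfl
    · refine ⟨k.succAbove i, ⟨hj, (hr _).mpr (Or.inr rfl)⟩, ?_⟩
      rintro y ⟨h1, h2⟩
      exact ((hr y).mp h2).resolve_left h1
    · refine ⟨j, ⟨hj.symm, (hr _).mpr (Or.inl rfl)⟩, ?_⟩
      rintro y ⟨h1, h2⟩
      exact ((hr y).mp h2).resolve_right h1
  · refine Finset.sum_nbij (fun b => j.insertNth (!b) (i.insertNth b x : Fin (m + 1) → Bool))
      ?_ ?_ ?_ ?_
    · intro b _
      simp only [Finset.mem_filter, Finset.mem_univ, true_and]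
      constructor
      · intro p q hp hq hpq
        rcases (hr p).mp hp with rfl | rfl <;> rcases (hr q).mp hq with rfl | rfl <;> simp_all
      · ext k; simp [ι]
    · intro b _ b' _ h
      simpa using congrFun h j
    · intro y hy
      simp only [Finset.coe_filter, Finset.mem_univ, true_and, Set.mem_ofPred_eq] at hy
      refine ⟨y (j.succAbove i), by simp, ?_⟩
      ext z
      refine Fin.succAboveCases j ?_ (fun z => ?_) z
      · have := hy.1 j (j.succAbove i) ((hr _).mpr (Or.inl rfl)) ((hr _).mpr (Or.inr rfl)) hj.symm
        revert this; cases y j <;> cases y (j.succAbove i) <;> simp_all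
      · refine Fin.succAboveCases i ?_ (fun z => ?_) z
        · simp
        · simp [← hy.2, ι]
    · intro b _; rfl

theorem refines_addLoop {m : ℕ} (f : (Fin (m + 2) → Bool) → ℂ) (j : Fin (m + 2))
    (i : Fin (m + 1)) (c : ℕ) (edge : Fin m → List Bool) :
    (addLoop f j i (freshName c) edge).Refines c ⟨joined f j i, edge⟩ :=
  refinesVal_loopEdge f j i c edge

open Classical in
/-- Replace a vertex with the signature `joined f j i` by a vertex with the signature `f` and
a loop. -/
noncomputable def expand {m : ℕ} (f : (Fin (m + 2) → Bool) → ℂ) (j : Fin (m + 2))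
    (i : Fin (m + 1)) (c : ℕ) (v : Vertex) : Vertex :=
  if h : v.sig = joined f j i then
    addLoop f j i (freshName c) fun k => v.edge (Fin.cast (congrArg Signature.arity h).symm k)
  else v.mark

variable {m : ℕ} (f : (Fin (m + 2) → Bool) → ℂ) (j : Fin (m + 2)) (i : Fin (m + 1)) (c : ℕ)

theorem expand_of_eq (edge : Fin m → List Bool) :
    expand f j i c ⟨joined f j i, edge⟩ = addLoop f j i (freshName c) edge := by
  unfold expand
  rw [dif_pos rfl]
  rfl

theorem expand_of_ne {v : Vertex} (h : v.sig ≠ joined f j i) : expand f j i c v = v.mark :=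
  dif_neg h

theorem refines_expand (v : Vertex) : (expand f j i c v).Refines c v := by
  by_cases h : v.sig = joined f j i
  · obtain ⟨sig, edge⟩ := v
    simp only at h
    subst h
    exact (expand_of_eq f j i c edge).symm ▸ refines_addLoop f j i c edge
  · rw [expand_of_ne f j i c h]
    exact refines_mark c v

theorem expand_sig_mem {F : Set Signature} (hf : (⟨m + 2, f⟩ : Signature) ∈ F) {v : Vertex}
    (hv : v.sig ∈ {joined f j i} ∪ F) : (expand f j i c v).sig ∈ F := by
  by_cases h : v.sig = joined f j i
  · unfold expand
    rw [dif_pos h]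
    exact hf
  · rw [expand_of_ne f j i c h]
    exact hv.resolve_left h

end Vertex

open Signature in
/-- The grid in which the vertices with the signature `joined f j i` are replaced. -/
noncomputable def SignatureGrid.expand {F : Set Signature} {m : ℕ}
    {f : (Fin (m + 2) → Bool) → ℂ} (hf : (⟨m + 2, f⟩ : Signature) ∈ F) (j : Fin (m + 2))
    (i : Fin (m + 1)) (G : SignatureGrid ({joined f j i} ∪ F)) : SignatureGrid F where
  order := G.order
  vertex k := (G.vertex k).expand f j i k
  sig_mem k := Vertex.expand_sig_mem f j i k hf (G.sig_mem k)
  two_ends := two_ends_of_refines (fun k => Vertex.refines_expand f j i k _) G.two_ends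

open Signature in
theorem SignatureGrid.partitionFunction_expand {F : Set Signature} {m : ℕ}
    {f : (Fin (m + 2) → Bool) → ℂ} (hf : (⟨m + 2, f⟩ : Signature) ∈ F) (j : Fin (m + 2))
    (i : Fin (m + 1)) (hF : ∀ g ∈ F, g.IsEO) (hg : (joined f j i).IsEO)
    (G : SignatureGrid ({joined f j i} ∪ F)) :
    partitionFunction G.vertex = partitionFunction (G.expand hf j i).vertex :=
  partitionFunction_eq_of_refines (fun k => Vertex.refines_expand f j i k _)
    (fun k => hF _ ((G.expand hf j i).sig_mem k)) fun k => by
      rcases G.sig_mem k with h | h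
      · rw [h]; exact hg
      · exact hF _ h

/-! ### Running programs on tapes of symbols of length one -/

namespace Program

/-- The store with the given words on the stacks `0` to `4`. -/
def tapes (w o c d e : List Letter) : Store := fun k =>
  (match k with
    | 0 => w
    | 1 => o
    | 2 => c
    | 3 => d
    | 4 => e
    | _ => []).map fun a => ⟨a, 1⟩

theorem init_eq_tapes (w : List Letter) : Store.init w = tapes w [] [] [] [] := by
  funext k
  rcases k with _ | _ | _ | _ | _ | k <;> simp [Store.init, tapes]

section tapes

variable (w o c d e x : List Letter) (a : Letter)

@[simp] theorem tapes_zero : tapes w o c d e 0 = w.map fun a => ⟨a, 1⟩ := rfl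
@[simp] theorem tapes_one : tapes w o c d e 1 = o.map fun a => ⟨a, 1⟩ := rfl
@[simp] theorem tapes_two : tapes w o c d e 2 = c.map fun a => ⟨a, 1⟩ := rfl
@[simp] theorem tapes_three : tapes w o c d e 3 = d.map fun a => ⟨a, 1⟩ := rfl
@[simp] theorem tapes_four : tapes w o c d e 4 = e.map fun a => ⟨a, 1⟩ := rfl

theorem update_zero : Function.update (tapes w o c d e) 0 (x.map fun a => ⟨a, 1⟩) =
    tapes x o c d e := by
  funext k; rcases k with _ | _ | _ | _ | _ | k <;> simp [tapes]

theorem update_one : Function.update (tapes w o c d e) 1 (x.map fun a => ⟨a, 1⟩) =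
    tapes w x c d e := by
  funext k; rcases k with _ | _ | _ | _ | _ | k <;> simp [tapes]

theorem update_two : Function.update (tapes w o c d e) 2 (x.map fun a => ⟨a, 1⟩) =
    tapes w o x d e := by
  funext k; rcases k with _ | _ | _ | _ | _ | k <;> simp [tapes]

theorem update_three : Function.update (tapes w o c d e) 3 (x.map fun a => ⟨a, 1⟩) =
    tapes w o c x e := by
  funext k; rcases k with _ | _ | _ | _ | _ | k <;> simp [tapes]

theorem update_four : Function.update (tapes w o c d e) 4 (x.map fun a => ⟨a, 1⟩) =
    tapes w o c d x := by
  funext k; rcases k with _ | _ | _ | _ | _ | k <;> simp [tapes]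

end tapes

/-- The program stops in the store `s'` after time at most `n`. -/
def RunsIn (O : CountingProblem) (P : Program) (s : Store) (n : ℕ) (s' : Store) : Prop :=
  ∃ m ≤ n, Run O P s m s'

variable {O : CountingProblem} {P Q : Program} {s s' s'' : Store} {m n : ℕ} {t : Test}
  {w o c d e : List Letter} {a : Letter}

namespace RunsIn

theorem mono (h : RunsIn O P s m s') (hmn : m ≤ n) : RunsIn O P s n s' := by
  obtain ⟨k, hk, h⟩ := h
  exact ⟨k, hk.trans hmn, h⟩

theorem skip : RunsIn O .skip s 1 s :=
  ⟨1, le_rfl, .skip s⟩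

theorem seq (h : RunsIn O P s m s') (h' : RunsIn O Q s' n s'') :
    RunsIn O (.seq P Q) s (m + n) s'' := by
  obtain ⟨k, hk, h⟩ := h
  obtain ⟨l, hl, h'⟩ := h'
  exact ⟨k + l, add_le_add hk hl, .seq h h'⟩

theorem cond_true (ht : t.Holds s) (hc : t.cost s ≤ 2) (h : RunsIn O P s m s') :
    RunsIn O (.cond t P Q) s (2 + m) s' := by
  obtain ⟨k, hk, h⟩ := h
  exact ⟨_, add_le_add hc hk, .cond_true Q ht h⟩

theorem cond_false (ht : ¬ t.Holds s) (hc : t.cost s ≤ 2) (h : RunsIn O Q s m s') :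
    RunsIn O (.cond t P Q) s (2 + m) s' := by
  obtain ⟨k, hk, h⟩ := h
  exact ⟨_, add_le_add hc hk, .cond_false P ht h⟩

theorem loop_stop (ht : ¬ t.Holds s) (hc : t.cost s ≤ 2) : RunsIn O (.loop t P) s 2 s :=
  ⟨_, hc, Run.loop_stop P ht⟩

theorem loop_step (ht : t.Holds s) (hc : t.cost s ≤ 2) (h : RunsIn O P s m s')
    (h' : RunsIn O (.loop t P) s' n s'') : RunsIn O (.loop t P) s (2 + m + n) s'' := by
  obtain ⟨k, hk, h⟩ := h
  obtain ⟨l, hl, h'⟩ := h'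
  exact ⟨_, add_le_add (add_le_add hc hk) hl, .loop_step ht h h'⟩

theorem of_run (h : Run O P s n s') (e : s' = s'') : RunsIn O P s n s'' :=
  ⟨n, le_rfl, e ▸ h⟩

theorem push_one :
    RunsIn O (.push 1 a) (tapes w o c d e) 2 (tapes w (a :: o) c d e) :=
  of_run (Run.push 1 a _) (update_one _ _ _ _ _ (a :: o))

theorem push_two :
    RunsIn O (.push 2 a) (tapes w o c d e) 2 (tapes w o (a :: c) d e) :=
  of_run (Run.push 2 a _) (update_two _ _ _ _ _ (a :: c))

theorem push_four :
    RunsIn O (.push 4 a) (tapes w o c d e) 2 (tapes w o c d (a :: e)) :=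
  of_run (Run.push 4 a _) (update_four _ _ _ _ _ (a :: e))

theorem pop_zero :
    RunsIn O (.pop 0) (tapes (a :: w) o c d e) 1 (tapes w o c d e) :=
  of_run (Run.pop 0 _) (update_zero _ _ _ _ _ w)

theorem pop_one :
    RunsIn O (.pop 1) (tapes w (a :: o) c d e) 1 (tapes w o c d e) :=
  of_run (Run.pop 1 _) (update_one _ _ _ _ _ o)

theorem pop_two :
    RunsIn O (.pop 2) (tapes w o (a :: c) d e) 1 (tapes w o c d e) :=
  of_run (Run.pop 2 _) (update_two _ _ _ _ _ c)

theorem pop_three :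
    RunsIn O (.pop 3) (tapes w o c (a :: d) e) 1 (tapes w o c d e) :=
  of_run (Run.pop 3 _) (update_three _ _ _ _ _ d)

theorem pop_four :
    RunsIn O (.pop 4) (tapes w o c d (a :: e)) 1 (tapes w o c d e) :=
  of_run (Run.pop 4 _) (update_four _ _ _ _ _ e)

theorem copy_zero_one :
    RunsIn O (.copy 0 1) (tapes (a :: w) o c d e) 2 (tapes (a :: w) (a :: o) c d e) :=
  of_run (Run.copy 0 1 _ ⟨a, 1⟩ rfl) (update_one _ _ _ _ _ (a :: o))

theorem copy_one_zero :
    RunsIn O (.copy 1 0) (tapes w (a :: o) c d e) 2 (tapes (a :: w) (a :: o) c d e) :=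
  of_run (Run.copy 1 0 _ ⟨a, 1⟩ rfl) (update_zero _ _ _ _ _ (a :: w))

theorem copy_two_one :
    RunsIn O (.copy 2 1) (tapes w o (a :: c) d e) 2 (tapes w (a :: o) (a :: c) d e) :=
  of_run (Run.copy 2 1 _ ⟨a, 1⟩ rfl) (update_one _ _ _ _ _ (a :: o))

theorem copy_two_three :
    RunsIn O (.copy 2 3) (tapes w o (a :: c) d e) 2 (tapes w o (a :: c) (a :: d) e) :=
  of_run (Run.copy 2 3 _ ⟨a, 1⟩ rfl) (update_three _ _ _ _ _ (a :: d))

theorem copy_three_two :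
    RunsIn O (.copy 3 2) (tapes w o c (a :: d) e) 2 (tapes w o (a :: c) (a :: d) e) :=
  of_run (Run.copy 3 2 _ ⟨a, 1⟩ rfl) (update_two _ _ _ _ _ (a :: c))

end RunsIn

section tests

variable {b : Letter}

theorem holds_zero : (Test.isConst 0 b).Holds (tapes w o c d e) ↔ w.head? = some b := by
  cases w <;> simp [Test.Holds, Store.topLetter]

theorem holds_two : (Test.isConst 2 b).Holds (tapes w o c d e) ↔ c.head? = some b := by
  cases c <;> simp [Test.Holds, Store.topLetter]

theorem holds_three : (Test.isConst 3 b).Holds (tapes w o c d e) ↔ d.head? = some b := by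
  cases d <;> simp [Test.Holds, Store.topLetter]

theorem holds_four : (Test.isConst 4 b).Holds (tapes w o c d e) ↔ e.head? = some b := by
  cases e <;> simp [Test.Holds, Store.topLetter]

theorem holds_empty_zero : (Test.empty 0).Holds (tapes w o c d e) ↔ w = [] := by
  simp [Test.Holds]

theorem holds_empty_one : (Test.empty 1).Holds (tapes w o c d e) ↔ o = [] := by
  simp [Test.Holds]

/-- Every cell of `tapes` has length `1`, so the cost of a test is bounded uniformly. -/
theorem cost_isConst (i : ℕ) : (Test.isConst i b).cost (tapes w o c d e) ≤ 2 := by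
  have : (tapes w o c d e).topLen i ≤ 1 := by
    simp only [Store.topLen, tapes, List.head?_map]
    generalize List.head? _ = x
    cases x <;> simp
  simp only [Test.cost]; omega

theorem cost_empty (i : ℕ) (s : Store) : (Test.empty i).cost s ≤ 2 := by
  simp [Test.cost]

end tests

/-! ### The program that replaces the vertices -/

/-- Move the top of stack `0` to stack `1`. -/
def move : Program := .seq (.copy 0 1) (.pop 0)

/-- Move the bits on top of stack `0` to stack `1`. -/
def moveBits : Program :=
  .seq (.push 4 (.bit true)) (.loop (.isConst 4 (.bit true))
    (.cond (.isConst 0 (.bit true)) move (.cond (.isConst 0 (.bit false)) move (.pop 4))))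

/-- Move the name of an edge from stack `0` to stack `1` and mark it. -/
def moveName : Program := .seq move (.seq (.push 1 (.bit false)) moveBits)

/-- Move `k` names. -/
def moveNames : ℕ → Program
  | 0 => .skip
  | k + 1 => .seq moveName (moveNames k)

/-- Move names as long as there are some. -/
def moveAllNames : Program := .loop (.isConst 0 .sep) moveName

/-- Write a fresh name on stack `1`, using the counter on stack `2`. -/
def writeFresh : Program :=
  .seq (.push 1 .sep) (.seq (.push 1 (.bit true)) (.seq
    (.loop (.isConst 2 (.bit true)) (.seq (.copy 2 1) (.seq (.copy 2 3) (.pop 2))))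
    (.loop (.isConst 3 (.bit true)) (.seq (.copy 3 2) (.pop 3)))))

/-- Process a vertex: if the signature is `g`, replace it by `f` and put a fresh name after `i`
and after `d` more names. -/
def processVertex (g f : Signature) (i d : ℕ) : Program :=
  .seq (.cond (.isConst 0 (.label g))
    (.seq (.pop 0) (.seq (.push 1 (.label f)) (.seq (moveNames i) (.seq writeFresh
      (.seq (moveNames d) (.seq writeFresh moveAllNames))))))
    (.seq move moveAllNames)) (.push 2 (.bit true))

/-- Process all vertices, reverse the result and ask the oracle. -/
def reduction (g f : Signature) (i d : ℕ) : Program :=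
  .seq (.push 4 .sep) (.seq
    (.loop (.isConst 4 .sep) (.cond (.empty 0) (.pop 4) (processVertex g f i d)))
    (.seq (.push 4 .sep) (.seq
      (.loop (.isConst 4 .sep) (.cond (.empty 1) (.pop 4) (.seq (.copy 1 0) (.pop 1))))
      (.query 0 0))))

/-- Edge names as they are written down. -/
def namesWord (L : List (List Bool)) : List Letter :=
  L.flatMap fun name => Letter.sep :: name.map Letter.bit

theorem namesWord_append (L M : List (List Bool)) :
    namesWord (L ++ M) = namesWord L ++ namesWord M :=
  List.flatMap_append

theorem namesWord_cons (x : List Bool) (L : List (List Bool)) :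
    namesWord (x :: L) = Letter.sep :: (x.map Letter.bit ++ namesWord L) :=
  rfl

theorem length_map_cons_le (L : List (List Bool)) :
    (namesWord (L.map (false :: ·))).length ≤ 2 * (namesWord L).length := by
  induction L with
  | nil => simp [namesWord]
  | cons x L ih =>
    rw [List.map_cons, namesWord_cons, namesWord_cons]
    simp only [List.length_cons, List.length_append, List.length_map]
    omega

/-- The word does not start with a bit. -/
def NoBit (t : List Letter) : Prop :=
  ∀ b, t.head? ≠ some (.bit b)

theorem noBit_namesWord {L : List (List Bool)} {t : List Letter} (ht : NoBit t) :
    NoBit (namesWord L ++ t) := by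
  cases L with
  | nil => simpa [namesWord] using ht
  | cons x L => intro b; simp [namesWord]

theorem move_runs : RunsIn O move (tapes (a :: w) o c d e) 3 (tapes w (a :: o) c d e) :=
  RunsIn.copy_zero_one.seq .pop_zero

/-- `Test` cannot say that the top symbol is any bit, so the loop is driven by a flag on stack `4`
that is popped at the first non-bit. The hypothesis `he` ensures that no second flag lies
underneath. -/
theorem moveBits_runs (x : List Bool) {t : List Letter} (ht : NoBit t)
    (o : List Letter) (he : e.head? ≠ some (.bit true)) :
    RunsIn O moveBits (tapes (x.map .bit ++ t) o c d e) (10 * x.length + 12)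
      (tapes t ((x.map .bit).reverse ++ o) c d e) := by
  refine (RunsIn.push_four.seq (n := 10 * x.length + 10) ?_).mono (by omega)
  induction x generalizing o with
  | nil =>
    have ht' : ∀ b, ¬ (Test.isConst 0 (.bit b)).Holds (tapes t o c d (.bit true :: e)) :=
      fun b => by rw [holds_zero]; exact ht b
    refine (RunsIn.loop_step (by rw [holds_four]; rfl) (cost_isConst _)
      (RunsIn.cond_false (ht' _) (cost_isConst _) (RunsIn.cond_false (ht' _) (cost_isConst _)
        RunsIn.pop_four)) (RunsIn.loop_stop (by rwa [holds_four]) (cost_isConst _))).mono (by simp)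
  | cons b x ih =>
    have h1 : RunsIn O (.cond (.isConst 0 (.bit true)) move
        (.cond (.isConst 0 (.bit false)) move (.pop 4)))
        (tapes ((b :: x).map .bit ++ t) o c d (.bit true :: e)) 7
        (tapes (x.map .bit ++ t) (.bit b :: o) c d (.bit true :: e)) := by
      cases b with
      | true =>
        exact (RunsIn.cond_true (by rw [holds_zero]; rfl) (cost_isConst _) move_runs).mono
          (by omega)
      | false =>
        exact (RunsIn.cond_false (by rw [holds_zero]; simp) (cost_isConst _)
          (RunsIn.cond_true (by rw [holds_zero]; rfl) (cost_isConst _) move_runs)).mono (by omega)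
    have h2 : ((b :: x).map Letter.bit).reverse ++ o = (x.map .bit).reverse ++ .bit b :: o := by
      simp
    rw [h2]
    refine (RunsIn.loop_step (by rw [holds_four]; rfl) (cost_isConst _) h1 (ih _)).mono ?_
    simp only [List.length_cons]; omega

theorem moveName_runs (x : List Bool) {t : List Letter} (ht : NoBit t) (o : List Letter)
    (he : e.head? ≠ some (.bit true)) :
    RunsIn O moveName (tapes (namesWord [x] ++ t) o c d e) (20 * (namesWord [x]).length)
      (tapes t ((namesWord [false :: x]).reverse ++ o) c d e) := by
  have h1 : namesWord [x] ++ t = .sep :: (x.map .bit ++ t) := by simp [namesWord]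
  have h2 : (namesWord [false :: x]).reverse ++ o =
      (x.map Letter.bit).reverse ++ .bit false :: .sep :: o := by simp [namesWord]
  rw [h1, h2]
  refine (move_runs.seq (RunsIn.push_one.seq (moveBits_runs x ht _ he))).mono ?_
  simp [namesWord]; omega

theorem moveNames_runs (L : List (List Bool)) {t : List Letter} (ht : NoBit t) (o : List Letter)
    (he : e.head? ≠ some (.bit true)) :
    RunsIn O (moveNames L.length) (tapes (namesWord L ++ t) o c d e)
      (20 * (namesWord L).length + 1)
      (tapes t ((namesWord (L.map (false :: ·))).reverse ++ o) c d e) := by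
  induction L generalizing o with
  | nil => exact RunsIn.skip
  | cons x L ih =>
    have h1 : namesWord (x :: L) = namesWord [x] ++ namesWord L := namesWord_append [x] L
    have h2 : (namesWord ((x :: L).map (false :: ·))).reverse ++ o =
        (namesWord (L.map (false :: ·))).reverse ++ ((namesWord [false :: x]).reverse ++ o) := by
      rw [List.map_cons, ← List.singleton_append, namesWord_append, List.reverse_append,
        List.append_assoc]
    rw [h2, h1, List.append_assoc]
    refine ((moveName_runs x (noBit_namesWord ht) _ he).seq (ih _)).mono ?_
    rw [List.length_append]; omega

theorem moveAllNames_runs (L : List (List Bool)) {t : List Letter} (ht : NoBit t)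
    (ht' : t.head? ≠ some .sep) (o : List Letter) (he : e.head? ≠ some (.bit true)) :
    RunsIn O moveAllNames (tapes (namesWord L ++ t) o c d e) (22 * (namesWord L).length + 2)
      (tapes t ((namesWord (L.map (false :: ·))).reverse ++ o) c d e) := by
  induction L generalizing o with
  | nil => exact RunsIn.loop_stop (by rwa [holds_zero]) (cost_isConst _)
  | cons x L ih =>
    have h1 : namesWord (x :: L) = namesWord [x] ++ namesWord L := namesWord_append [x] L
    have h2 : (namesWord ((x :: L).map (false :: ·))).reverse ++ o =
        (namesWord (L.map (false :: ·))).reverse ++ ((namesWord [false :: x]).reverse ++ o) := by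
      rw [List.map_cons, ← List.singleton_append, namesWord_append, List.reverse_append,
        List.append_assoc]
    rw [h2, h1, List.append_assoc]
    refine (RunsIn.loop_step (by rw [holds_zero]; rfl) (cost_isConst _)
      (moveName_runs x (noBit_namesWord ht) _ he) (ih _)).mono ?_
    rw [List.length_append]
    have : 0 < (namesWord [x]).length := by simp [namesWord]
    omega

theorem replicate_append_cons (k : ℕ) (l : List Letter) :
    List.replicate k a ++ a :: l = List.replicate (k + 1) a ++ l := by
  rw [List.replicate_succ', List.append_assoc, List.singleton_append]

/-- Copying the unary counter to the output consumes it, so a second copy is kept on stack `3` and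
moved back afterwards. -/
theorem writeFresh_runs (k : ℕ) :
    RunsIn O writeFresh (tapes w o (List.replicate k (.bit true)) [] e) (12 * k + 8)
      (tapes w ((namesWord [freshName k]).reverse ++ o) (List.replicate k (.bit true)) [] e) := by
  have h1 : ∀ k l o, RunsIn O
      (.loop (.isConst 2 (.bit true)) (.seq (.copy 2 1) (.seq (.copy 2 3) (.pop 2))))
      (tapes w o (List.replicate k (.bit true)) (List.replicate l (.bit true)) e) (7 * k + 2)
      (tapes w (List.replicate k (.bit true) ++ o) [] (List.replicate (k + l) (.bit true)) e) := by
    intro k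
    induction k with
    | zero =>
      intro l o
      rw [zero_add]
      exact RunsIn.loop_stop (by rw [holds_two]; simp) (cost_isConst _)
    | succ k ih =>
      intro l o
      have := ih (l + 1) (.bit true :: o)
      rw [replicate_append_cons, ← add_assoc, add_right_comm] at this
      exact (RunsIn.loop_step (by rw [holds_two]; rfl) (cost_isConst _)
        (RunsIn.copy_two_one.seq (RunsIn.copy_two_three.seq .pop_two)) this).mono (by omega)
  have h2 : ∀ k l o, RunsIn O (.loop (.isConst 3 (.bit true)) (.seq (.copy 3 2) (.pop 3)))
      (tapes w o (List.replicate l (.bit true)) (List.replicate k (.bit true)) e) (5 * k + 2)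
      (tapes w o (List.replicate (k + l) (.bit true)) [] e) := by
    intro k
    induction k with
    | zero =>
      intro l o
      rw [zero_add]
      exact RunsIn.loop_stop (by rw [holds_three]; simp) (cost_isConst _)
    | succ k ih =>
      intro l o
      have := ih (l + 1) o
      rw [← add_assoc, add_right_comm] at this
      exact (RunsIn.loop_step (by rw [holds_three]; rfl) (cost_isConst _)
        (RunsIn.copy_three_two.seq .pop_three) this).mono (by omega)
  have h3 : (namesWord [freshName k]).reverse ++ o =
      List.replicate k (Letter.bit true) ++ .bit true :: .sep :: o := by
    simp [namesWord, freshName]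
  rw [h3]
  exact (RunsIn.push_one.seq (RunsIn.push_one.seq ((h1 k 0 _).seq (h2 k 0 _)))).mono (by omega)

end Program

/-! ### Words of grids with additional loops -/

theorem ofFn_insertNth {X : Type*} {m : ℕ} (i : Fin (m + 1)) (a : X) (x : Fin m → X) :
    List.ofFn (i.insertNth a x : Fin (m + 1) → X) =
      (List.ofFn x).take i ++ a :: (List.ofFn x).drop i := by
  induction m with
  | zero =>
    obtain rfl : i = 0 := Fin.ext (by omega)
    simp
  | succ m ih =>
    refine Fin.cases ?_ (fun i => ?_) i
    · simp [List.ofFn_succ]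
    · have h : (fun k : Fin (m + 1) => (i.succ.insertNth a x : Fin (m + 2) → X) k.succ) =
          i.insertNth a fun k => x k.succ := by
        ext k
        refine Fin.succAboveCases i ?_ (fun k => ?_) k
        · simp
        · rw [← Fin.succ_succAbove_succ, Fin.insertNth_apply_succAbove,
            Fin.insertNth_apply_succAbove]
      have h0 : (i.succ.insertNth a x : Fin (m + 2) → X) 0 = x 0 := by
        have h0 : i.succ.succAbove 0 = 0 := Fin.succ_succAbove_zero i
        rw [← h0, Fin.insertNth_apply_succAbove]
      rw [List.ofFn_succ, h, h0, ih, List.ofFn_succ (f := x)]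
      simp

namespace Vertex

open Program Signature

theorem word_eq (v : Vertex) : v.word = .label v.sig :: namesWord (List.ofFn v.edge) :=
  rfl

/-- Since `i` precedes `j`, the first fresh name stands after `i` old names. Of the `j` entries
before the second fresh name, one is the first fresh name, which leaves `j - 1 - i` old names
between the two. -/
theorem ofFn_loopEdge {m : ℕ} {j : Fin (m + 2)} {i : Fin (m + 1)} (hij : i.castSucc < j)
    (name : List Bool) (edge : Fin m → List Bool) :
    List.ofFn (loopEdge j i name edge) = ((List.ofFn edge).take i).map (false :: ·) ++ name ::
      ((((List.ofFn edge).drop i).take (j - 1 - i)).map (false :: ·) ++ name ::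
        (((List.ofFn edge).drop i).drop (j - 1 - i)).map (false :: ·)) := by
  have h : List.ofFn (fun k => false :: edge k) = (List.ofFn edge).map (false :: ·) := by
    rw [List.map_ofFn]; rfl
  have hij' : (i : ℕ) < j := hij
  have hi := i.is_lt
  obtain ⟨d, hd⟩ : ∃ d, (j : ℕ) = i + (d + 1) := ⟨j - 1 - i, by omega⟩
  rw [loopEdge, ofFn_insertNth, ofFn_insertNth, h, hd]
  have hlen : (((List.ofFn edge).map (false :: ·)).take (i : ℕ)).length = i := by
    simp; omega
  have e : (i : ℕ) + (d + 1) - 1 - i = d := by omega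
  have e1 := List.take_of_length_le (i := i + (d + 1))
    (l := ((List.ofFn edge).map (false :: ·)).take i) (by rw [hlen]; omega)
  have e2 := List.drop_of_length_le (i := i + (d + 1))
    (l := ((List.ofFn edge).map (false :: ·)).take i) (by rw [hlen]; omega)
  rw [List.take_append, List.drop_append, hlen, e, Nat.add_sub_cancel_left, e1, e2]
  simp only [List.take_succ_cons, List.drop_succ_cons, List.map_take, List.map_drop,
    List.append_assoc, List.cons_append, List.nil_append]

end Vertex

/-! ### Correctness and running time of the program -/

namespace Program

open Vertex Signature

variable {O : CountingProblem} {w o : List Letter} {m : ℕ} {f : (Fin (m + 2) → Bool) → ℂ}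
  {j : Fin (m + 2)} {i : Fin (m + 1)}

theorem word_expand_of_eq (hij : i.castSucc < j) (k : ℕ) (edge : Fin m → List Bool) :
    (expand f j i k ⟨joined f j i, edge⟩).word = .label ⟨m + 2, f⟩ ::
      (namesWord (((List.ofFn edge).take i).map (false :: ·)) ++ (namesWord [freshName k] ++
      (namesWord ((((List.ofFn edge).drop i).take (j - 1 - i)).map (false :: ·)) ++
      (namesWord [freshName k] ++
      namesWord ((((List.ofFn edge).drop i).drop (j - 1 - i)).map (false :: ·)))))) := by
  rw [expand_of_eq]
  show Letter.label ⟨m + 2, f⟩ :: namesWord (List.ofFn (loopEdge j i (freshName k) edge)) = _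
  rw [ofFn_loopEdge hij]
  simp only [← namesWord_append, List.singleton_append]

theorem word_expand_of_ne {v : Vertex} (h : v.sig ≠ joined f j i) (k : ℕ) :
    (expand f j i k v).word = .label v.sig :: namesWord ((List.ofFn v.edge).map (false :: ·)) := by
  rw [expand_of_ne f j i k h, word_eq, List.map_ofFn]
  rfl

theorem namesWord_split (L : List (List Bool)) (i d : ℕ) : namesWord L =
    namesWord (L.take i) ++ (namesWord ((L.drop i).take d) ++ namesWord ((L.drop i).drop d)) := by
  rw [← namesWord_append, List.take_append_drop, ← namesWord_append, List.take_append_drop]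

/-- Marking at most doubles the names, and each of the two fresh names takes `k + 2` symbols with
its separator. -/
theorem length_word_expand_le (hij : i.castSucc < j) (k : ℕ) (v : Vertex) :
    (expand f j i k v).word.length ≤ 2 * v.word.length + 2 * (k + 2) := by
  have key : ∀ edge : Fin m → List Bool, (expand f j i k ⟨joined f j i, edge⟩).word.length ≤
      2 * (Vertex.mk (joined f j i) edge).word.length + 2 * (k + 2) := by
    intro edge
    have h1 := length_map_cons_le ((List.ofFn edge).take i)
    have h2 := length_map_cons_le (((List.ofFn edge).drop i).take (j - 1 - i))
    have h3 := length_map_cons_le (((List.ofFn edge).drop i).drop (j - 1 - i))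
    have h4 : (namesWord [freshName k]).length = k + 2 := by simp [namesWord, freshName]
    have h5 : (Vertex.mk (joined f j i) edge).word.length =
        (namesWord (List.ofFn edge)).length + 1 := rfl
    have h6 := congrArg List.length (namesWord_split (List.ofFn edge) i (j - 1 - i))
    rw [word_expand_of_eq hij, h5, h6]
    simp only [List.length_append, List.length_cons]
    omega
  by_cases h : v.sig = joined f j i
  · obtain ⟨sig, edge⟩ := v
    simp only at h
    subst h
    exact key edge
  · rw [word_expand_of_ne h, word_eq]
    have h1 := length_map_cons_le (List.ofFn v.edge)
    simp only [List.length_cons]; omega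

/-- The flag of the main loop is `.sep`, so it cannot be mistaken for the flag `.bit true` of
`moveBits`. The output is built in reverse, and the counter advances for every vertex, whether or
not a loop is added. -/
theorem processVertex_runs (hij : i.castSucc < j) (k : ℕ) (v : Vertex) {t : List Letter}
    (ht : NoBit t) (ht' : t.head? ≠ some .sep) :
    RunsIn O (processVertex (joined f j i) ⟨m + 2, f⟩ i (j - 1 - i))
      (tapes (v.word ++ t) o (List.replicate k (.bit true)) [] [.sep])
      (22 * v.word.length + 24 * k + 27)
      (tapes t ((expand f j i k v).word.reverse ++ o) (List.replicate (k + 1) (.bit true)) []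
        [.sep]) := by
  have he : [Letter.sep].head? ≠ some (.bit true) := by simp
  refine (RunsIn.seq (n := 2) (m := 22 * v.word.length + 24 * k + 25) ?_ RunsIn.push_two)
  by_cases h : v.sig = joined f j i
  · suffices key : ∀ edge : Fin m → List Bool, RunsIn O
        (.cond (.isConst 0 (.label (joined f j i)))
          (.seq (.pop 0) (.seq (.push 1 (.label ⟨m + 2, f⟩)) (.seq (moveNames i) (.seq writeFresh
            (.seq (moveNames (j - 1 - i)) (.seq writeFresh moveAllNames))))))
          (.seq move moveAllNames))
        (tapes ((Vertex.mk (joined f j i) edge).word ++ t) o (List.replicate k (.bit true)) []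
          [.sep])
        (22 * (Vertex.mk (joined f j i) edge).word.length + 24 * k + 25)
        (tapes t ((expand f j i k ⟨joined f j i, edge⟩).word.reverse ++ o)
          (List.replicate k (.bit true)) [] [.sep]) by
      obtain ⟨sig, edge⟩ := v
      simp only at h
      subst h
      exact key edge
    intro edge
    have e := word_expand_of_eq (f := f) hij k edge
    have e' : (Vertex.mk (joined f j i) edge).word = .label (joined f j i) ::
        namesWord (List.ofFn edge) := rfl
    have hij' : (i : ℕ) < j := hij
    have h1 := i.is_lt
    have h2 := j.is_lt
    have l1 : ((List.ofFn edge).take i).length = i := by simp; omega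
    have l2 : (((List.ofFn edge).drop i).take (j - 1 - i)).length = j - 1 - i := by simp; omega
    have sp := namesWord_split (List.ofFn edge) i (j - 1 - i)
    rw [e, e', sp]
    simp only [List.reverse_cons, List.reverse_append, List.append_assoc, List.cons_append,
      List.nil_append]
    have r1 := moveNames_runs (O := O) ((List.ofFn edge).take i) (t :=
      namesWord (((List.ofFn edge).drop i).take (j - 1 - i)) ++
        (namesWord (((List.ofFn edge).drop i).drop (j - 1 - i)) ++ t))
      (c := List.replicate k (.bit true)) (d := []) (noBit_namesWord (noBit_namesWord ht))
      (.label ⟨m + 2, f⟩ :: o) he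
    have r2 := fun o => moveNames_runs (O := O) (((List.ofFn edge).drop i).take (j - 1 - i)) (t :=
      namesWord (((List.ofFn edge).drop i).drop (j - 1 - i)) ++ t)
      (c := List.replicate k (.bit true)) (d := []) (noBit_namesWord ht) o he
    rw [l1] at r1
    rw [l2] at r2
    refine (RunsIn.cond_true (by rw [holds_zero]; rfl) (cost_isConst _)
      (RunsIn.pop_zero.seq (RunsIn.push_one.seq (r1.seq ((writeFresh_runs k).seq ((r2 _).seq
        ((writeFresh_runs k).seq (moveAllNames_runs _ ht ht' _ he)))))))).mono ?_
    simp only [List.length_append, List.length_cons]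
    omega
  · rw [word_expand_of_ne h, word_eq]
    simp only [List.reverse_cons, List.append_assoc, List.cons_append, List.nil_append]
    refine (RunsIn.cond_false (by rw [holds_zero]; simpa using h) (cost_isConst _)
      (move_runs.seq (moveAllNames_runs _ ht ht' _ he))).mono ?_
    simp only [List.length_cons]; omega

theorem gridWord_succ {n : ℕ} (v : Fin (n + 1) → Vertex) :
    gridWord v = (v 0).word ++ gridWord fun k => v k.succ := by
  simp [gridWord, List.ofFn_succ]

theorem head?_gridWord {n : ℕ} (v : Fin n → Vertex) {a : Letter} (h : (gridWord v).head? = some a) :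
    ∃ g, a = .label g := by
  cases n with
  | zero => simp [gridWord] at h
  | succ n =>
    rw [gridWord_succ, word_eq] at h
    exact ⟨_, by simpa [eq_comm] using h⟩

theorem gridWord_ne_nil {n : ℕ} (v : Fin (n + 1) → Vertex) : gridWord v ≠ [] := by
  rw [gridWord_succ, word_eq]; simp

theorem le_length_gridWord {n : ℕ} (v : Fin n → Vertex) : n ≤ (gridWord v).length := by
  induction n with
  | zero => simp
  | succ n ih =>
    have := ih fun k => v k.succ
    rw [gridWord_succ, word_eq]
    simp only [List.length_append, List.length_cons]; omega

/-- The offset `k` is the counter value at the first vertex of the remaining list, as needed for the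
induction. Unary fresh names make the growth quadratic. -/
theorem length_gridWord_expand_le (hij : i.castSucc < j) {n : ℕ} (k : ℕ) (v : Fin n → Vertex) :
    (gridWord fun x => expand f j i (k + x) (v x)).length ≤
      2 * (gridWord v).length + n * (2 * (k + n) + 4) := by
  induction n generalizing k with
  | zero => simp [gridWord]
  | succ n ih =>
    rw [gridWord_succ, gridWord_succ]
    have h1 := length_word_expand_le (f := f) hij k (v 0)
    have h2 := ih (k + 1) fun x => v x.succ
    simp only [Fin.val_succ, Fin.val_zero, add_zero, List.length_append] at h1 h2 ⊢
    simp only [add_assoc, add_comm 1] at h2 ⊢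
    nlinarith

/-- Induction on the remaining vertices, with the counter and the output written so far as
parameters. Looping until stack `0` is empty is again done with a flag, since tests cannot be
negated. -/
theorem processVertices_runs (hij : i.castSucc < j) {n : ℕ} (k : ℕ) (v : Fin n → Vertex)
    (o : List Letter) :
    RunsIn O (.loop (.isConst 4 .sep) (.cond (.empty 0) (.pop 4)
        (processVertex (joined f j i) ⟨m + 2, f⟩ i (j - 1 - i))))
      (tapes (gridWord v) o (List.replicate k (.bit true)) [] [.sep])
      (22 * (gridWord v).length + n * (24 * (k + n) + 31) + 7)
      (tapes [] ((gridWord fun x => expand f j i (k + x) (v x)).reverse ++ o)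
        (List.replicate (k + n) (.bit true)) [] []) := by
  induction n generalizing k o with
  | zero =>
    exact (RunsIn.loop_step (by rw [holds_four]; rfl) (cost_isConst _)
      (RunsIn.cond_true (by rw [holds_empty_zero]; rfl) (cost_empty _ _) RunsIn.pop_four)
      (RunsIn.loop_stop (by rw [holds_four]; simp) (cost_isConst _))).mono (by omega)
  | succ n ih =>
    have h1 : NoBit (gridWord fun x => v x.succ) := fun b h => by
      obtain ⟨g, hg⟩ := head?_gridWord _ h
      cases hg
    have h2 : (gridWord fun x => v x.succ).head? ≠ some .sep := fun h => by
      obtain ⟨g, hg⟩ := head?_gridWord _ h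
      cases hg
    have h3 := ih (k + 1) (fun x => v x.succ) ((expand f j i k (v 0)).word.reverse ++ o)
    have h4 : (gridWord fun x : Fin (n + 1) => expand f j i (k + x) (v x)).reverse ++ o =
        (gridWord fun x : Fin n => expand f j i (k + 1 + x) (v x.succ)).reverse ++
          ((expand f j i k (v 0)).word.reverse ++ o) := by
      rw [gridWord_succ]
      simp only [Fin.val_succ, Fin.val_zero, add_zero, List.reverse_append, List.append_assoc]
      simp only [add_assoc, add_comm 1]
    have h5 : k + (n + 1) = k + 1 + n := by omega
    have h6 : ¬ (Test.empty 0).Holds (tapes (gridWord v) o (List.replicate k (.bit true)) []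
        [.sep]) := by
      rw [holds_empty_zero]; exact gridWord_ne_nil v
    have h7 := processVertex_runs (O := O) (o := o) (f := f) hij k (v 0) h1 h2
    rw [← gridWord_succ] at h7
    rw [h4, h5]
    refine (RunsIn.loop_step (by rw [holds_four]; rfl) (cost_isConst _)
      (RunsIn.cond_false h6 (cost_empty _ _) h7) h3).mono ?_
    rw [gridWord_succ, List.length_append]
    nlinarith

theorem reverse_runs {c d : List Letter} (o w : List Letter) :
    RunsIn O (.loop (.isConst 4 .sep) (.cond (.empty 1) (.pop 4) (.seq (.copy 1 0) (.pop 1))))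
      (tapes w o c d [.sep]) (7 * o.length + 7) (tapes (o.reverse ++ w) [] c d []) := by
  induction o generalizing w with
  | nil =>
    exact (RunsIn.loop_step (by rw [holds_four]; rfl) (cost_isConst _)
      (RunsIn.cond_true (by rw [holds_empty_one]) (cost_empty _ _) RunsIn.pop_four)
      (RunsIn.loop_stop (by rw [holds_four]; simp) (cost_isConst _))).mono (by simp)
  | cons a o ih =>
    have h := ih (a :: w)
    have e : (a :: o).reverse ++ w = o.reverse ++ a :: w := by simp
    rw [e]
    refine (RunsIn.loop_step (by rw [holds_four]; rfl) (cost_isConst _)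
      (RunsIn.cond_false (by rw [holds_empty_one]; simp) (cost_empty _ _)
        (RunsIn.copy_one_zero.seq .pop_one)) h).mono ?_
    simp only [List.length_cons]; omega

end Program

/-! ### The reduction and the main theorem -/

open Signature Program in
/-- Joining two variables of a signature in `F` by an edge gives a signature that can be added to
`F` without making the problem harder. -/
theorem polyTimeTuringReducible_joined {F : Set Signature} (hF : ∀ g ∈ F, g.IsEO) {m : ℕ}
    {f : (Fin (m + 2) → Bool) → ℂ} (hf : (⟨m + 2, f⟩ : Signature) ∈ F) {j : Fin (m + 2)}
    {i : Fin (m + 1)} (hij : i.castSucc < j) (hg : (joined f j i).IsEO) :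
    PolyTimeTuringReducible (EOProblem ({joined f j i} ∪ F)) (EOProblem F) := by
  -- A quadratic bound suffices because each vertex contributes its label, so the number of
  -- vertices, and with it each counter value, is at most the input length. The factor `200` is
  -- generous.
  refine ⟨reduction (joined f j i) ⟨m + 2, f⟩ i (j - 1 - i), 200 * (Polynomial.X + 1) ^ 2,
    fun G => ?_⟩
  change SignatureGrid _ at G
  have hval := G.partitionFunction_expand hf j i hF hg
  let G' := G.expand hf j i
  have hword : gridWord G'.vertex =
      gridWord fun x : Fin G.order => (G.vertex x).expand f j i (0 + x) := by
    simp only [zero_add]; rfl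
  have r1 := processVertices_runs (O := EOProblem F) (f := f) hij 0 G.vertex []
  rw [← hword, List.append_nil] at r1
  have r2 := reverse_runs (O := EOProblem F) (c := List.replicate (0 + G.order) (.bit true))
    (d := []) (gridWord G'.vertex).reverse []
  rw [List.reverse_reverse, List.append_nil] at r2
  -- The query is legitimate: after the reversal, stack `0` holds exactly the word of the expanded
  -- grid.
  have hquery := Run.query (O := EOProblem F) 0 0 (tapes (gridWord G'.vertex) []
    (List.replicate (0 + G.order) (.bit true)) [] []) G' (by
      simp only [tapes_zero, List.map_map]
      exact List.map_id _)
  have r3 : RunsIn (EOProblem F) (.query 0 0) _ _ _ := ⟨_, le_rfl, hquery⟩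
  obtain ⟨t, ht, hrun⟩ := RunsIn.push_four.seq (r1.seq (RunsIn.push_four.seq (r2.seq r3)))
  rw [List.replicate_zero, ← init_eq_tapes] at hrun
  refine ⟨t, _, hrun, ?_, ?_⟩
  · show t ≤ Polynomial.eval (gridWord G.vertex).length _
    have h1 := le_length_gridWord G.vertex
    have h2 := length_gridWord_expand_le (f := f) hij 0 G.vertex
    rw [← hword] at h2
    simp only [tapes_zero, List.length_map, List.length_reverse, zero_add] at ht h2
    simp only [Polynomial.eval_mul, Polynomial.eval_pow, Polynomial.eval_add, Polynomial.eval_X,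
      Polynomial.eval_one, Polynomial.eval_ofNat]
    clear hquery r1 r2 r3 hrun hval hword
    generalize (gridWord G.vertex).length = N at *
    generalize (gridWord G'.vertex).length = M at *
    generalize G.order = n at *
    have h3 : n * n ≤ N * N := Nat.mul_le_mul h1 h1
    nlinarith
  · simp only [Store.topLetter, Store.push, Function.update_self, List.head?_cons, Option.map_some]
    exact congrArg (fun z => some (Letter.number z)) hval.symm

theorem lemma4p6 (F : Set Signature) (hF : ∀ f ∈ F, f.IsEO ∧ f.IsARS)
    (f : Signature) (hf : f ∈ F) (n : ℕ) (hn : 10 ≤ 2 * n) (harity : f.arity = 2 * n)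
    (hB : f ∉ Signature.setB) :
    ∃ g : Signature, g.IsEO ∧ g.IsARS ∧ g.arity = 2 * n - 2 ∧ g ∉ Signature.setB ∧
      PolyTimeTuringReducible (EOProblem ({g} ∪ F)) (EOProblem F) := by
  obtain ⟨hEO, hARS⟩ := hF f hf
  obtain ⟨arity, f⟩ := f
  obtain ⟨m, rfl⟩ : ∃ m, arity = m + 2 := ⟨arity - 2, by simp only at harity; omega⟩
  simp only at harity
  obtain ⟨j, i, hij, hg⟩ : ∃ (j : Fin (m + 2)) (i : Fin (m + 1)), i.castSucc < j ∧
      Signature.joined f j i ∉ Signature.setB := by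
    by_contra! h
    exact hB (Signature.mem_setB_of_joined hEO hARS (by omega) h)
  have hgEO : (Signature.joined f j i).IsEO := Signature.IsEO.joined j i hEO (by omega)
  exact ⟨Signature.joined f j i, hgEO, Signature.IsARS.joined j i hARS,
    by simp only [Signature.joined]; omega, hg,
    polyTimeTuringReducible_joined (fun g hg => (hF g hg).1) hf hij hgEO⟩
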